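/- Let $n\ge 6$ and let $E_n$ denote the graph with vertices $0,1,\dots,n-1$ in which $1,2,\dots,n-1$ form a path (in this order) and $0$ is joined to $3$ only. Let $\mathcal A=\mathbb Z[v,v^{-1}]$ and $\delta=v+v^{-1}$. Let $\mathcal H$ be the Hecke algebra over $\mathcal A$, with parameter $q=v^2$, of the Coxeter group $W(E_n)$ with generators $s_0,\dots,s_{n-1}$ and graph $E_n$: the unital $\mathcal A$-algebra generated by elements $T_s$ subject to $T_s^2=(q-1)T_s+q$, $T_sT_t=T_tT_s$ if $s\neq t$ are not adjacent, and $T_sT_tT_s=T_tT_sT_t$ if $s,t$ are adjacent. Let $TL(E_n)$ be the quotient of $\mathcal H$ by the two-sided ideal generated by the elements $1+T_s+T_t+T_sT_t+T_tT_s+T_sT_tT_s$ for adjacent $s,t$, and let $b_s\in TL(E_n)$ be the image of $v^{-1}(1+T_s)$. Let $K$ be a field containing $\mathcal A$ and a square root of $\delta$, and put $TL_K(E_n)=K\otimes_{\mathcal A}TL(E_n)$. A trace on $TL_K(E_n)$ is a $K$-linear map $\tau:TL_K(E_n)\to K$ with $\tau(ab)=\tau(ba)$ for all $a,b$. Let $P$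 be the set of all sets of pairwise non-adjacent vertices of $E_n$ (including $\emptyset$). For $A\in P$ let $i(A)$ be the product of the pairwise commuting elements $b_s$, $s\in A$ (with $i(\emptyset)=1$). Two sets $A,B\in P$ are neighbours if $1+\#(A\cap B)=\#A=\#B$ and the two vertices in $(A\cup B)\setminus(A\cap B)$ are adjacent. Let $\sim$ be the reflexive and transitive closure of the neighbour relation (an equivalence relation), and let $\bar P=P/{\sim}$. **Theorem 5.3.** For each $\bar A\in\bar P$ there is a unique trace $\tau_{\bar A}:TL_K(E_n)\to K$ such that for each $B\in P$ $$\tau_{\bar A}(i(B))=\begin{cases}1&\text{if }B\in\bar A,\\0&\text{otherwise.}\end{cases}$$ The family $\{\tau_{\bar A}:\bar A\in\bar P\}$ is a $K$-basis of the $K$-vector space of all traces on $TL_K(E_n)$. -/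

import Mathlib

open scoped TensorProduct

/-- The graph of type `E_n`: the vertices `0, 1, …, n - 1`, where `1, 2, …, n - 1` lie in a straight
line and `0` is joined to `3` only. -/
def typeEGraph (n : ℕ) : SimpleGraph (Fin n) where
  Adj i j :=
    (1 ≤ i.val ∧ i.val + 1 = j.val) ∨ (1 ≤ j.val ∧ j.val + 1 = i.val) ∨
      (i.val = 0 ∧ j.val = 3) ∨ (i.val = 3 ∧ j.val = 0)
  symm := ⟨by
    intro i j h
    omega⟩
  loopless := ⟨by
    intro i h
    omega⟩

open Classical in
/-- The Coxeter matrix of the simply laced Coxeter group with graph `G`: `m(s, s) = 1`,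
`m(s, t) = 3` if `s` and `t` are adjacent, and `m(s, t) = 2` otherwise. -/
noncomputable def simplyLacedMatrix {V : Type*} (G : SimpleGraph V) : CoxeterMatrix V where
  M := Matrix.of fun s t => if s = t then 1 else if G.Adj s t then 3 else 2
  isSymm := by
    ext s t
    simp only [Matrix.transpose_apply, Matrix.of_apply, eq_comm (a := t) (b := s),
      G.adj_comm t s]
  diagonal := by
    intro s
    simp
  off_diagonal := by
    intro s t h
    simp only [Matrix.of_apply, if_neg h]
    split_ifs <;> norm_num

/-- The Coxeter matrix of type `E_n`. -/
noncomputable abbrev typeEMatrix (n : ℕ) : CoxeterMatrix (Fin n) :=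
  simplyLacedMatrix (typeEGraph n)

/-- The indeterminate `v` of the ring `ℤ[v, v⁻¹]`. -/
noncomputable abbrev vParam : LaurentPolynomial ℤ := LaurentPolynomial.T 1

/-- The element `v⁻¹` of the ring `ℤ[v, v⁻¹]`. -/
noncomputable abbrev vInv : LaurentPolynomial ℤ := LaurentPolynomial.T (-1)

/-- The element `δ = v + v⁻¹` of the ring `ℤ[v, v⁻¹]`. -/
noncomputable abbrev deltaParam : LaurentPolynomial ℤ := vParam + vInv

/-- The defining relations of the Hecke algebra with parameter `q = v ^ 2`: the quadratic relations
`T_s ^ 2 = (q - 1) T_s + q` and the braid relations `T_s T_t T_s ⋯ = T_t T_s T_t ⋯`, with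
`m(s, t)` factors on both sides (the value `0` of a Coxeter matrix stands for `∞`). -/
inductive HeckeRel {V : Type*} (M : CoxeterMatrix V) :
    FreeAlgebra (LaurentPolynomial ℤ) V → FreeAlgebra (LaurentPolynomial ℤ) V → Prop
  | quadratic (s : V) :
      HeckeRel M
        (FreeAlgebra.ι (LaurentPolynomial ℤ) s * FreeAlgebra.ι (LaurentPolynomial ℤ) s)
        ((vParam ^ 2 - 1) • FreeAlgebra.ι (LaurentPolynomial ℤ) s +
          algebraMap (LaurentPolynomial ℤ) (FreeAlgebra (LaurentPolynomial ℤ) V) (vParam ^ 2))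
  | braid (s t : V) (h : M s t ≠ 0) :
      HeckeRel M
        ((CoxeterSystem.alternatingWord s t (M s t)).map
          (FreeAlgebra.ι (LaurentPolynomial ℤ))).prod
        ((CoxeterSystem.alternatingWord t s (M s t)).map
          (FreeAlgebra.ι (LaurentPolynomial ℤ))).prod

/-- The Iwahori–Hecke algebra over `ℤ[v, v⁻¹]`, with parameter `q = v ^ 2`, of the Coxeter group
with Coxeter matrix `M`. -/
def HeckeAlgebra {V : Type*} (M : CoxeterMatrix V) : Type _ := RingQuot (HeckeRel M)

noncomputable instance {V : Type*} (M : CoxeterMatrix V) : Ring (HeckeAlgebra M) :=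
  inferInstanceAs (Ring (RingQuot (HeckeRel M)))

noncomputable instance {V : Type*} (M : CoxeterMatrix V) :
    Algebra (LaurentPolynomial ℤ) (HeckeAlgebra M) :=
  inferInstanceAs (Algebra (LaurentPolynomial ℤ) (RingQuot (HeckeRel M)))

/-- The quotient map from the free algebra to the Hecke algebra. -/
noncomputable def freeToHecke {V : Type*} (M : CoxeterMatrix V) :
    FreeAlgebra (LaurentPolynomial ℤ) V →ₐ[LaurentPolynomial ℤ] HeckeAlgebra M :=
  RingQuot.mkAlgHom (LaurentPolynomial ℤ) (HeckeRel M)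

/-- The generator `T_s` of the Hecke algebra. -/
noncomputable def heckeT {V : Type*} (M : CoxeterMatrix V) (s : V) : HeckeAlgebra M :=
  freeToHecke M (FreeAlgebra.ι (LaurentPolynomial ℤ) s)

/-- The relations `T_1 + T_s + T_t + T_{st} + T_{ts} + T_{sts} = 0` for `m(s, t) = 3`.
For such `s` and `t` the words `st`, `ts`, `sts` are reduced, so that `T_{st} = T_s T_t`,
`T_{ts} = T_t T_s` and `T_{sts} = T_s T_t T_s`. -/
inductive TLRel {V : Type*} (M : CoxeterMatrix V) : HeckeAlgebra M → HeckeAlgebra M → Prop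
  | mk (s t : V) (h : M s t = 3) :
      TLRel M
        (1 + heckeT M s + heckeT M t + heckeT M s * heckeT M t + heckeT M t * heckeT M s +
          heckeT M s * heckeT M t * heckeT M s) 0

/-- The generalized Temperley–Lieb algebra over `ℤ[v, v⁻¹]`: the quotient of the Hecke algebra by
the two-sided ideal generated by the elements `T_1 + T_s + T_t + T_{st} + T_{ts} + T_{sts}` with
`m(s, t) = 3`. -/
def TemperleyLieb {V : Type*} (M : CoxeterMatrix V) : Type _ := RingQuot (TLRel M)

noncomputable instance {V : Type*} (M : CoxeterMatrix V) : Ring (TemperleyLieb M) :=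
  inferInstanceAs (Ring (RingQuot (TLRel M)))

noncomputable instance {V : Type*} (M : CoxeterMatrix V) :
    Algebra (LaurentPolynomial ℤ) (TemperleyLieb M) :=
  inferInstanceAs (Algebra (LaurentPolynomial ℤ) (RingQuot (TLRel M)))

/-- The canonical epimorphism from the Hecke algebra to the Temperley–Lieb algebra. -/
noncomputable def heckeToTL {V : Type*} (M : CoxeterMatrix V) :
    HeckeAlgebra M →ₐ[LaurentPolynomial ℤ] TemperleyLieb M :=
  RingQuot.mkAlgHom (LaurentPolynomial ℤ) (TLRel M)

/-- The generator `b_s = v⁻¹ 1 + v⁻¹ t_s` of the Temperley–Lieb algebra, `t_s` being the image of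
`T_s`. -/
noncomputable def tlB {V : Type*} (M : CoxeterMatrix V) (s : V) : TemperleyLieb M :=
  vInv • (1 : TemperleyLieb M) + vInv • heckeToTL M (heckeT M s)

theorem heckeT_commute {V : Type*} (M : CoxeterMatrix V) {s t : V} (h : M s t = 2) :
    Commute (heckeT M s) (heckeT M t) := by
  have key : freeToHecke M _ = freeToHecke M _ := RingQuot.mkAlgHom_rel (LaurentPolynomial ℤ)
    (HeckeRel.braid (M := M) s t (by rw [h]; norm_num))
  rw [h] at key
  simpa [CoxeterSystem.alternatingWord, heckeT, Commute, SemiconjBy] using key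

theorem tlB_commute {V : Type*} (M : CoxeterMatrix V) {s t : V} (h : M s t = 2) :
    Commute (tlB M s) (tlB M t) := by
  have h1 : Commute (heckeToTL M (heckeT M s)) (heckeToTL M (heckeT M t)) :=
    (heckeT_commute M h).map (heckeToTL M)
  unfold tlB
  exact ((((Commute.one_left _).smul_left _).add_left
    (((Commute.one_right _).smul_right _).add_right ((h1.smul_left _).smul_right _))))

/-- `P(n)`: the sets of pairwise non-adjacent vertices of the graph `E_n`, including `∅`. -/
abbrev IndepSets (n : ℕ) : Type :=
  {A : Finset (Fin n) // (typeEGraph n).IsIndepSet (A : Set (Fin n))}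

theorem tlB_pairwise_commute {n : ℕ} (A : IndepSets n) :
    (A.1 : Set (Fin n)).Pairwise (Function.onFun Commute (tlB (typeEMatrix n))) := by
  intro s hs t ht hst
  refine tlB_commute _ ?_
  have hadj := A.2 hs ht hst
  simp [simplyLacedMatrix, hst, hadj]

/-- `i(A)`: the product of the commuting generators `b_s`, `s ∈ A`. -/
noncomputable def iElt {n : ℕ} (A : IndepSets n) : TemperleyLieb (typeEMatrix n) :=
  A.1.noncommProd (tlB (typeEMatrix n)) (tlB_pairwise_commute A)

/-- `A` and `B` are neighbours: `1 + #(A ∩ B) = #A = #B`, and the two vertices in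
`(A ∪ B) \ (A ∩ B)` are adjacent. -/
def Neighbours {n : ℕ} (A B : IndepSets n) : Prop :=
  1 + (A.1 ∩ B.1).card = A.1.card ∧ A.1.card = B.1.card ∧
    ∃ s t : Fin n, (A.1 ∪ B.1) \ (A.1 ∩ B.1) = {s, t} ∧ (typeEGraph n).Adj s t

theorem Neighbours.symm {n : ℕ} {A B : IndepSets n} (h : Neighbours A B) : Neighbours B A := by
  obtain ⟨h1, h2, s, t, h3, h4⟩ := h
  refine ⟨?_, h2.symm, s, t, ?_, h4⟩
  · rw [Finset.inter_comm, h1, h2]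
  · rw [Finset.union_comm, Finset.inter_comm, h3]

/-- The reflexive and transitive closure of the neighbour relation. -/
def neighbourSetoid (n : ℕ) : Setoid (IndepSets n) where
  r := Relation.ReflTransGen Neighbours
  iseqv :=
    { refl := fun _ => Relation.ReflTransGen.refl
      symm := by
        intro A B h
        induction h with
        | refl => exact Relation.ReflTransGen.refl
        | tail _ hbc ih => exact Relation.ReflTransGen.head hbc.symm ih
      trans := fun h1 h2 => h1.trans h2 }

/-- The set of equivalence classes of `P(n)`. -/
abbrev IndepClasses (n : ℕ) : Type := Quotient (neighbourSetoid n)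

/-- The class of `A`. -/
def classOf {n : ℕ} (A : IndepSets n) : IndepClasses n := Quotient.mk (neighbourSetoid n) A

/-- The `K`-form `K ⊗ TL(E_n)` of the Temperley–Lieb algebra of type `E_n`, the tensor product
being over `ℤ[v, v⁻¹]`. -/
abbrev TLK (K : Type*) [Field K] [Algebra (LaurentPolynomial ℤ) K] (n : ℕ) : Type _ :=
  K ⊗[LaurentPolynomial ℤ] TemperleyLieb (typeEMatrix n)

/-- The element `i(A)` of the `K`-form. -/
noncomputable def iEltK (K : Type*) [Field K] [Algebra (LaurentPolynomial ℤ) K] {n : ℕ}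
    (A : IndepSets n) : TLK K n :=
  (1 : K) ⊗ₜ[LaurentPolynomial ℤ] iElt A

/-- The space of traces on a `K`-algebra `R`: the linear maps `τ : R → K` with
`τ (a * b) = τ (b * a)` for all `a` and `b`. -/
def traceSpace (K R : Type*) [Field K] [Ring R] [Algebra K R] : Submodule K (R →ₗ[K] K) where
  carrier := {τ | ∀ a b : R, τ (a * b) = τ (b * a)}
  add_mem' := by
    intro σ τ hσ hτ a b
    rw [LinearMap.add_apply, LinearMap.add_apply, hσ a b, hτ a b]
  zero_mem' := by
    intro a b
    rfl
  smul_mem' := by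
    intro c τ hτ a b
    rw [LinearMap.smul_apply, LinearMap.smul_apply, hτ a b]

/-!
Write `b_w` for the monomial `b_{s₁} ⋯ b_{sₖ}` of a word `w`. The `b_s` satisfy `b_s² = δ b_s`,
`b_s b_t b_s = b_s` for adjacent `s, t`, and commute otherwise, and these relations define the
algebra. So a trace is the same thing as a function on words that respects these relations and is
invariant under rotation (`exists_linearMap_monomialK`, `trace_of_monomialK`).

*Uniqueness* (`trace_ext`). Suppose that a trace vanishes on all `i(A)`, and let `w` be a shortest
word on whose monomial it does not vanish; read `w` cyclically, as a periodic sequence. If `s` has a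
neighbour in `w`, the gap between consecutive occurrences of `s` has at least two neighbours of `s`:
with none or one, the relations (and `δ ≠ 0`, when `s` occurs only once in a period) would shorten
`w`. In the graph `E_n` such a sequence cannot have adjacent letters
(`TwoNeighboursInGaps.not_adj`): on each of the three arms occurrences of the next vertex
are separated by those of the vertex nearer to `3`; counting the letters `0`, `2`, `4` in
consecutive gaps of `3` shows that every such gap has a `4`, and this propagates along the long arm until it
fails at the leaf `n - 1`. Hence `w` lists an independent set without repetitions, and its monomial
is some `i(A)`.

*Existence* (`exists_trace_class`). By the relations, it suffices to read off from a word `w`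
functions that detect the exponent `k` and the class of `A` when `b_w` equals `δ^k i(A)`
modulo commutators. For `δ = √2` there is an explicit representation: `√2 b_s` is sent to `1 + g_s`,
where the involutions `g_s` anticommute for adjacent vertices and commute otherwise (`cliff`).
Let `B_w` be the product of the `1 + g_s` along `w`. The traces of `B_w` and `B_w²` are
multiplied by `2` and `4` when a relation shortens `w`, and they are `2^n` and
`2^(n + #A)` for a word listing `A`; together they determine `k` and `#A`. For odd `n` the product
of the `g_s` over `{0, 4, 6, …, n - 1}` is central, and the trace of its product with `B_w` tells
whether `A` contains this set. Finally the size and, for odd `n`, this containment determine the class of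
`A`, as every class contains a set packed towards the leaf `n - 1` (`exists_isPacked`) and
packed sets are determined by these data (`IsPacked.eq_of_card_eq`).
-/

open scoped TensorProduct

/-! ### The monomial presentation of the Temperley–Lieb algebra -/

section Presentation

theorem vInv_mul_vParam : vInv * vParam = 1 := by
  rw [← LaurentPolynomial.T_add]; simp

theorem deltaParam_ne_zero : deltaParam ≠ 0 := by
  intro h
  -- the evaluation at `v = 1` sends `δ` to `2`
  have h1 := congrArg (LaurentPolynomial.eval₂ (RingHom.id ℤ) 1) h
  simp [deltaParam] at h1

/-- The quadratic Hecke relation for `x` says that `b = w(1 + x)` satisfies `b² = (v + w)b`. -/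
theorem sq_of_hecke {A R : Type*} [CommRing A] [Ring R] [Algebra A R] {v w : A} (hvw : w * v = 1)
    {x : R} (hx : x * x = (v ^ 2 - 1) • x + algebraMap A R (v ^ 2)) :
    (w • (1 : R) + w • x) * (w • (1 : R) + w • x) = (v + w) • (w • (1 : R) + w • x) := by
  have h1 : (1 + x) * (1 + x) = (v ^ 2 + 1) • (1 + x) := by
    simp only [add_mul, mul_add, one_mul, mul_one, hx, Algebra.algebraMap_eq_smul_one]
    module
  rw [← smul_add, smul_mul_smul_comm, h1, smul_smul, smul_smul]
  congr 1
  linear_combination (w * v) * hvw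

/-- Given the quadratic relation for `x`, the Temperley–Lieb relation says that `b = w(1 + x)` and
`c = w(1 + y)` satisfy `bcb = b`. -/
theorem braid_of_hecke {A R : Type*} [CommRing A] [Ring R] [Algebra A R] {v w : A}
    (hvw : w * v = 1) {x y : R} (hx : x * x = (v ^ 2 - 1) • x + algebraMap A R (v ^ 2))
    (hxy : 1 + x + y + x * y + y * x + x * y * x = 0) :
    (w • (1 : R) + w • x) * (w • (1 : R) + w • y) * (w • (1 : R) + w • x) =
      w • (1 : R) + w • x := by
  have h1 : (1 + x) * (1 + y) * (1 + x) = v ^ 2 • (1 + x) := by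
    have : (1 + x) * (1 + y) * (1 + x) =
        (1 + x + y + x * y + y * x + x * y * x) + (x + x * x) := by noncomm_ring
    rw [this, hxy, hx, Algebra.algebraMap_eq_smul_one]
    module
  simp only [← smul_add]
  rw [smul_mul_smul_comm, smul_mul_smul_comm, h1, smul_smul]
  congr 1
  linear_combination (w * (w * v + 1)) * hvw

theorem hecke_of_sq {A R : Type*} [CommRing A] [Ring R] [Algebra A R] {v w : A} (hvw : w * v = 1)
    {b : R} (hb : b * b = (v + w) • b) :
    (v • b - 1) * (v • b - 1) = (v ^ 2 - 1) • (v • b - 1) + algebraMap A R (v ^ 2) := by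
  have h1 : (v • b - 1) * (v • b - 1) = (v * v) • (b * b) - (2 * v) • b + 1 := by
    simp only [sub_mul, mul_sub, one_mul, mul_one, smul_mul_smul_comm]
    module
  have h2 : v * v * (v + w) = v ^ 3 + v := by linear_combination v * hvw
  rw [h1, hb, smul_smul, h2, Algebra.algebraMap_eq_smul_one]
  module

/-- Since the left-hand side without the last summand is symmetric, this also yields the braid
relation for `vb - 1` and `vc - 1`. -/
theorem hecke_of_braid {A R : Type*} [CommRing A] [Ring R] [Algebra A R] {v w : A}
    (hvw : w * v = 1) {b c : R} (hb : b * b = (v + w) • b) (hbc : b * c * b = b) :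
    1 + (v • b - 1) + (v • c - 1) + (v • b - 1) * (v • c - 1) + (v • c - 1) * (v • b - 1) +
      (v • b - 1) * (v • c - 1) * (v • b - 1) = 0 := by
  have h1 : 1 + (v • b - 1) + (v • c - 1) + (v • b - 1) * (v • c - 1) + (v • c - 1) * (v • b - 1) +
      (v • b - 1) * (v • c - 1) * (v • b - 1) =
      (v • b) * (v • c) * (v • b) - (v • b) * (v • b) + v • b := by
    generalize v • b = x
    generalize v • c = y
    noncomm_ring
  rw [h1]
  simp only [smul_mul_smul_comm, hbc, hb, smul_smul]
  have h2 : v * v * (v + w) = v ^ 3 + v := by linear_combination v * hvw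
  rw [h2]
  module

variable {V : Type*}

theorem heckeT_mul_self (M : CoxeterMatrix V) (s : V) :
    heckeT M s * heckeT M s = (vParam ^ 2 - 1) • heckeT M s + algebraMap _ _ (vParam ^ 2) := by
  have key : freeToHecke M _ = freeToHecke M _ :=
    RingQuot.mkAlgHom_rel (LaurentPolynomial ℤ) (HeckeRel.quadratic (M := M) s)
  simp only [map_mul, map_add, map_smul, AlgHom.commutes] at key
  exact key

theorem heckeToTL_mul_self (M : CoxeterMatrix V) (s : V) :
    heckeToTL M (heckeT M s) * heckeToTL M (heckeT M s) =
      (vParam ^ 2 - 1) • heckeToTL M (heckeT M s) + algebraMap _ _ (vParam ^ 2) := by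
  have h1 := congrArg (heckeToTL M) (heckeT_mul_self M s)
  simpa only [map_mul, map_add, map_smul, AlgHom.commutes] using h1

theorem tlB_mul_self (M : CoxeterMatrix V) (s : V) :
    tlB M s * tlB M s = deltaParam • tlB M s :=
  sq_of_hecke vInv_mul_vParam (heckeToTL_mul_self M s)

theorem tlB_mul_mul (M : CoxeterMatrix V) {s t : V} (h : M s t = 3) :
    tlB M s * tlB M t * tlB M s = tlB M s := by
  refine braid_of_hecke vInv_mul_vParam (heckeToTL_mul_self M s) ?_
  have key : heckeToTL M _ = heckeToTL M _ :=
    RingQuot.mkAlgHom_rel (LaurentPolynomial ℤ) (TLRel.mk (M := M) s t h)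
  simpa only [map_mul, map_add, map_one, map_zero] using key

theorem heckeToTL_heckeT (M : CoxeterMatrix V) (s : V) :
    heckeToTL M (heckeT M s) = vParam • tlB M s - 1 := by
  unfold tlB
  rw [← smul_add, smul_smul, mul_comm, vInv_mul_vParam, one_smul, add_sub_cancel_left]

/-- The monomials in the `b_s` span the Temperley–Lieb algebra. -/
theorem span_tlB_prod (M : CoxeterMatrix V) :
    Submodule.span (LaurentPolynomial ℤ)
      (Set.range fun w : List V => (w.map (tlB M)).prod) = ⊤ := by
  set S := Submodule.span (LaurentPolynomial ℤ)
      (Set.range fun w : List V => (w.map (tlB M)).prod) with hS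
  have h1 : (1 : TemperleyLieb M) ∈ S := Submodule.subset_span ⟨[], by simp⟩
  have hmul : ∀ x ∈ S, ∀ y ∈ S, x * y ∈ S := by
    have : S * S ≤ S := by
      rw [hS, Submodule.span_mul_span, Submodule.span_le]
      rintro _ ⟨_, ⟨u, rfl⟩, _, ⟨w, rfl⟩, rfl⟩
      exact Submodule.subset_span ⟨u ++ w, by simp⟩
    exact fun x hx y hy => this (Submodule.mul_mem_mul hx hy)
  rw [eq_top_iff]
  rintro x -
  obtain ⟨y, rfl⟩ := RingQuot.mkAlgHom_surjective (LaurentPolynomial ℤ) (TLRel M) x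
  obtain ⟨z, rfl⟩ := RingQuot.mkAlgHom_surjective (LaurentPolynomial ℤ) (HeckeRel M) y
  change heckeToTL M (freeToHecke M z) ∈ S
  induction z using FreeAlgebra.induction with
  | grade0 r =>
    rw [AlgHom.commutes, AlgHom.commutes, Algebra.algebraMap_eq_smul_one]
    exact S.smul_mem _ h1
  | grade1 s =>
    change heckeToTL M (heckeT M s) ∈ S
    rw [heckeToTL_heckeT]
    exact S.sub_mem (S.smul_mem _ (Submodule.subset_span ⟨[s], by simp⟩)) h1
  | mul a b ha hb => rw [map_mul, map_mul]; exact hmul _ ha _ hb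
  | add a b ha hb => rw [map_add, map_add]; exact S.add_mem ha hb

variable (G : SimpleGraph V)

theorem simplyLacedMatrix_apply_of_adj {G : SimpleGraph V} {s t : V} (h : G.Adj s t) :
    simplyLacedMatrix G s t = 3 := by
  simp [simplyLacedMatrix, h, h.ne]

theorem simplyLacedMatrix_apply_of_not_adj {G : SimpleGraph V} {s t : V} (hne : s ≠ t)
    (h : ¬ G.Adj s t) : simplyLacedMatrix G s t = 2 := by
  simp [simplyLacedMatrix, h, hne]

theorem adj_of_simplyLacedMatrix_apply {G : SimpleGraph V} {s t : V}
    (h : simplyLacedMatrix G s t = 3) : G.Adj s t := by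
  by_contra hadj
  by_cases hne : s = t
  · subst hne; simp [simplyLacedMatrix] at h
  · rw [simplyLacedMatrix_apply_of_not_adj hne hadj] at h; omega

variable {G} in
/-- The universal property of the Temperley–Lieb algebra of a simply laced graph in terms of
the generators `b_s`. -/
theorem exists_lift_temperleyLieb {R : Type*} [Ring R] [Algebra (LaurentPolynomial ℤ) R]
    (b : V → R) (hsq : ∀ s, b s * b s = deltaParam • b s)
    (hadj : ∀ s t, G.Adj s t → b s * b t * b s = b s)
    (hcomm : ∀ s t, s ≠ t → ¬ G.Adj s t → b s * b t = b t * b s) :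
    ∃ f : TemperleyLieb (simplyLacedMatrix G) →ₐ[LaurentPolynomial ℤ] R,
      ∀ s, f (tlB (simplyLacedMatrix G) s) = b s := by
  set x : V → R := fun s => vParam • b s - 1 with hx
  have hTL : ∀ s t, G.Adj s t →
      1 + x s + x t + x s * x t + x t * x s + x s * x t * x s = 0 := fun s t h =>
    hecke_of_braid vInv_mul_vParam (hsq s) (hadj s t h)
  let f₀ : FreeAlgebra (LaurentPolynomial ℤ) V →ₐ[LaurentPolynomial ℤ] R := FreeAlgebra.lift _ x
  have hf₀ : ∀ s, f₀ (FreeAlgebra.ι _ s) = x s := fun s => FreeAlgebra.lift_ι_apply _ _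
  have hrel : ∀ ⦃a b⦄, HeckeRel (simplyLacedMatrix G) a b → f₀ a = f₀ b := by
    intro a c h
    induction h with
    | quadratic s =>
      simp only [map_mul, map_add, map_smul, AlgHom.commutes, hf₀]
      exact hecke_of_sq vInv_mul_vParam (hsq s)
    | braid s t _ =>
      by_cases hst : s = t
      · subst hst; rfl
      by_cases hG : G.Adj s t
      · rw [simplyLacedMatrix_apply_of_adj hG]
        simp only [CoxeterSystem.alternatingWord, List.concat_eq_append, List.nil_append,
          List.cons_append, List.map_cons, List.map_nil, List.prod_cons, List.prod_nil, mul_one,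
          map_mul, hf₀]
        have h1 := hTL s t hG
        have h2 := hTL t s hG.symm
        have h3 : x s * (x t * x s) - x t * (x s * x t) =
          (1 + x s + x t + x s * x t + x t * x s + x s * x t * x s) -
          (1 + x t + x s + x t * x s + x s * x t + x t * x s * x t) := by noncomm_ring
        rw [h1, h2, sub_zero] at h3
        first | exact sub_eq_zero.1 h3 | exact (sub_eq_zero.1 h3).symm
      · rw [simplyLacedMatrix_apply_of_not_adj hst hG]
        simp only [CoxeterSystem.alternatingWord, List.concat_eq_append, List.nil_append,
          List.cons_append, List.map_cons, List.map_nil, List.prod_cons, List.prod_nil, mul_one,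
          map_mul, hf₀]
        have h1 := hcomm s t hst hG
        have : Commute (x s) (x t) :=
          ((Commute.smul_left (Commute.smul_right h1 _) _).sub_left
            (Commute.one_left _)).sub_right (Commute.one_right _)
        exact this
  let f₁ : HeckeAlgebra (simplyLacedMatrix G) →ₐ[LaurentPolynomial ℤ] R :=
    RingQuot.liftAlgHom (LaurentPolynomial ℤ) ⟨f₀, hrel⟩
  have hf₁ : ∀ s, f₁ (heckeT _ s) = x s := fun s =>
    (RingQuot.liftAlgHom_mkAlgHom_apply (LaurentPolynomial ℤ) f₀ hrel _).trans (hf₀ s)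
  have hrel₁ : ∀ ⦃a b⦄, TLRel (simplyLacedMatrix G) a b → f₁ a = f₁ b := by
    intro a c h
    induction h with
    | mk s t h =>
      simp only [map_mul, map_add, map_one, map_zero, hf₁]
      exact hTL s t (adj_of_simplyLacedMatrix_apply h)
  let f₂ : TemperleyLieb (simplyLacedMatrix G) →ₐ[LaurentPolynomial ℤ] R :=
    RingQuot.liftAlgHom (LaurentPolynomial ℤ) ⟨f₁, hrel₁⟩
  have hf₂ : ∀ s, f₂ (heckeToTL _ (heckeT _ s)) = x s := fun s =>
    (RingQuot.liftAlgHom_mkAlgHom_apply (LaurentPolynomial ℤ) f₁ hrel₁ _).trans (hf₁ s)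
  refine ⟨f₂, fun s => ?_⟩
  rw [tlB, map_add, map_smul, map_smul, map_one, hf₂, hx, ← smul_add, add_sub_cancel, smul_smul,
    vInv_mul_vParam, one_smul]

end Presentation

section Scalars

variable (K : Type*) [Field K] [Algebra (LaurentPolynomial ℤ) K]

/-- The value of `δ` in the field `K`. -/
noncomputable abbrev deltaK : K := algebraMap (LaurentPolynomial ℤ) K deltaParam

theorem deltaK_ne_zero (hK : Function.Injective (algebraMap (LaurentPolynomial ℤ) K)) :
    deltaK K ≠ 0 :=
  (map_ne_zero_iff _ hK).2 deltaParam_ne_zero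

/-- The monomial `b_{s₁} ⋯ b_{sₖ}` in `K ⊗ TL(E_n)`. -/
noncomputable def monomialK {n : ℕ} (w : List (Fin n)) : TLK K n :=
  (1 : K) ⊗ₜ[LaurentPolynomial ℤ] (w.map (tlB (typeEMatrix n))).prod

variable {K} {n : ℕ}

theorem monomialK_append (u w : List (Fin n)) :
    monomialK K (u ++ w) = monomialK K u * monomialK K w := by
  simp [monomialK, Algebra.TensorProduct.tmul_mul_tmul]

theorem tmul_smul_eq_deltaK_smul (x : TemperleyLieb (typeEMatrix n)) :
    ((1 : K) ⊗ₜ[LaurentPolynomial ℤ] (deltaParam • x) : TLK K n) = deltaK K • (1 : K) ⊗ₜ x := by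
  rw [TensorProduct.tmul_smul, algebraMap_smul]

theorem monomialK_pair (s : Fin n) : monomialK K [s, s] = deltaK K • monomialK K [s] := by
  simp only [monomialK, List.map_cons, List.map_nil, List.prod_cons, List.prod_nil, mul_one,
    tlB_mul_self, tmul_smul_eq_deltaK_smul]

theorem monomialK_triple {s t : Fin n} (h : (typeEGraph n).Adj s t) :
    monomialK K [s, t, s] = monomialK K [s] := by
  simp only [monomialK, List.map_cons, List.map_nil, List.prod_cons, List.prod_nil, mul_one,
    ← mul_assoc, tlB_mul_mul _ (simplyLacedMatrix_apply_of_adj h)]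

theorem monomialK_comm {s t : Fin n} (h : ¬ (typeEGraph n).Adj s t) :
    monomialK K [s, t] = monomialK K [t, s] := by
  by_cases hst : s = t
  · rw [hst]
  simp only [monomialK, List.map_cons, List.map_nil, List.prod_cons, List.prod_nil, mul_one,
    (tlB_commute _ (simplyLacedMatrix_apply_of_not_adj hst h)).eq]

theorem span_monomialK : Submodule.span K (Set.range (monomialK K (n := n))) = ⊤ := by
  have h := congrArg (Submodule.baseChange K) (span_tlB_prod (typeEMatrix n))
  rw [Submodule.baseChange_span, Submodule.baseChange_top, ← Set.range_comp] at h
  exact h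

/-- A function on words that respects the monomial relations of `TL(E_n)` comes from a linear
functional. The algebra acts on the space of all such functions by
`(b_s φ)(w) = φ(w s)`, and the functional is `a ↦ (a φ)(1)`. -/
theorem exists_linearMap_monomialK (φ : List (Fin n) → K)
    (hsq : ∀ x y s, φ (x ++ [s, s] ++ y) = deltaK K * φ (x ++ [s] ++ y))
    (hadj : ∀ x y s t, (typeEGraph n).Adj s t → φ (x ++ [s, t, s] ++ y) = φ (x ++ [s] ++ y))
    (hcomm : ∀ x y s t, s ≠ t → ¬ (typeEGraph n).Adj s t →
      φ (x ++ [s, t] ++ y) = φ (x ++ [t, s] ++ y)) :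
    ∃ τ : TLK K n →ₗ[K] K, ∀ w, τ (monomialK K w) = φ w := by
  let N : Submodule K (List (Fin n) → K) :=
    { carrier := {φ | (∀ x y s, φ (x ++ [s, s] ++ y) = deltaK K * φ (x ++ [s] ++ y)) ∧
        (∀ x y s t, (typeEGraph n).Adj s t → φ (x ++ [s, t, s] ++ y) = φ (x ++ [s] ++ y)) ∧
        (∀ x y s t, s ≠ t → ¬ (typeEGraph n).Adj s t →
          φ (x ++ [s, t] ++ y) = φ (x ++ [t, s] ++ y))}
      add_mem' := by
        rintro f g ⟨h1, h2, h3⟩ ⟨k1, k2, k3⟩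
        refine ⟨fun x y s => ?_, fun x y s t h => ?_, fun x y s t h h' => ?_⟩
        · rw [Pi.add_apply, Pi.add_apply, h1, k1, mul_add]
        · rw [Pi.add_apply, Pi.add_apply, h2 x y s t h, k2 x y s t h]
        · rw [Pi.add_apply, Pi.add_apply, h3 x y s t h h', k3 x y s t h h']
      zero_mem' := by
        refine ⟨fun x y s => ?_, fun x y s t h => rfl, fun x y s t h h' => rfl⟩
        simp
      smul_mem' := by
        rintro c f ⟨h1, h2, h3⟩
        refine ⟨fun x y s => ?_, fun x y s t h => ?_, fun x y s t h h' => ?_⟩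
        · rw [Pi.smul_apply, Pi.smul_apply, h1, smul_eq_mul, smul_eq_mul, mul_left_comm]
        · rw [Pi.smul_apply, Pi.smul_apply, h2 x y s t h]
        · rw [Pi.smul_apply, Pi.smul_apply, h3 x y s t h h'] }
  let B : Fin n → Module.End K N := fun s =>
    { toFun := fun f => ⟨fun w => f.1 (w ++ [s]), by
        obtain ⟨f, h1, h2, h3⟩ := f
        refine ⟨fun x y r => ?_, fun x y r t h => ?_, fun x y r t h h' => ?_⟩
        · simpa only [List.append_assoc] using h1 x (y ++ [s]) r
        · simpa only [List.append_assoc] using h2 x (y ++ [s]) r t h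
        · simpa only [List.append_assoc] using h3 x (y ++ [s]) r t h h'⟩
      map_add' := fun f g => rfl
      map_smul' := fun c f => rfl }
  have hB : ∀ s (f : N) w, (B s f).1 w = f.1 (w ++ [s]) := fun _ _ _ => rfl
  obtain ⟨F, hF⟩ := exists_lift_temperleyLieb (G := typeEGraph n) B
    (by
      intro s
      refine LinearMap.ext fun f => Subtype.ext (funext fun w => ?_)
      have h := f.2.1 w [] s
      rw [List.append_nil, List.append_nil] at h
      rw [Module.End.mul_apply, hB, hB, List.append_assoc, List.singleton_append, h,
        ← algebraMap_smul K deltaParam (B s)]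
      rfl)
    (by
      intro s t h
      refine LinearMap.ext fun f => Subtype.ext (funext fun w => ?_)
      have h := f.2.2.1 w [] s t h
      rw [List.append_nil, List.append_nil] at h
      rw [Module.End.mul_apply, Module.End.mul_apply, hB, hB, hB, hB, ← h]
      simp)
    (by
      intro s t h h'
      refine LinearMap.ext fun f => Subtype.ext (funext fun w => ?_)
      have h := f.2.2.2 w [] s t h h'
      rw [List.append_nil, List.append_nil] at h
      rw [Module.End.mul_apply, Module.End.mul_apply, hB, hB, hB, hB]
      simpa using h)
  have hFw : ∀ (u : List (Fin n)) (f : N) w,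
      (F (u.map (tlB (typeEMatrix n))).prod f).1 w = f.1 (w ++ u) := by
    intro u
    induction u with
    | nil => intro f w; simp
    | cons s u ih =>
      intro f w
      rw [List.map_cons, List.prod_cons, map_mul, Module.End.mul_apply, hF, hB, ih]
      simp
  let FK : TLK K n →ₐ[K] Module.End K N :=
    Algebra.TensorProduct.lift (Algebra.ofId K _) F
      (fun a b => Algebra.commutes a (F b))
  let ev : Module.End K N →ₗ[K] K :=
    { toFun := fun g => (g ⟨φ, hsq, hadj, hcomm⟩).1 []
      map_add' := fun _ _ => rfl
      map_smul' := fun _ _ => rfl }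
  refine ⟨ev ∘ₗ FK.toLinearMap, fun w => ?_⟩
  have h1 : FK (monomialK K w) = F (w.map (tlB (typeEMatrix n))).prod := by
    refine (Algebra.TensorProduct.lift_tmul _ _ _ _ _).trans ?_
    rw [map_one, one_mul]
  rw [LinearMap.comp_apply, AlgHom.toLinearMap_apply, h1]
  change (F (w.map (tlB (typeEMatrix n))).prod ⟨φ, hsq, hadj, hcomm⟩).1 [] = φ w
  rw [hFw, List.nil_append]

/-- Two linear functionals that agree on all monomials are equal. -/
theorem linearMap_ext_monomialK {σ τ : TLK K n →ₗ[K] K}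
    (h : ∀ w, σ (monomialK K w) = τ (monomialK K w)) : σ = τ :=
  LinearMap.ext_on_range (span_monomialK (K := K) (n := n)) h

/-- The trace property has to be checked on monomials only. -/
theorem trace_of_monomialK {τ : TLK K n →ₗ[K] K}
    (h : ∀ u w, τ (monomialK K (u ++ w)) = τ (monomialK K (w ++ u))) (a b : TLK K n) :
    τ (a * b) = τ (b * a) := by
  have ha : a ∈ Submodule.span K (Set.range (monomialK K (n := n))) := by
    rw [span_monomialK]; trivial
  have hb : b ∈ Submodule.span K (Set.range (monomialK K (n := n))) := by
    rw [span_monomialK]; trivial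
  induction ha, hb using Submodule.span_induction₂ with
  | mem_mem x y hx hy =>
    obtain ⟨u, rfl⟩ := hx
    obtain ⟨w, rfl⟩ := hy
    rw [← monomialK_append, ← monomialK_append, h]
  | zero_left y hy => simp
  | zero_right x hx => simp
  | add_left x y z hx hy hz h1 h2 => simp only [add_mul, mul_add, map_add, h1, h2]
  | add_right x y z hx hy hz h1 h2 => simp only [add_mul, mul_add, map_add, h1, h2]
  | smul_left r x y hx hy h => simp only [smul_mul_assoc, mul_smul_comm, map_smul, h]
  | smul_right r x y hx hy h => simp only [smul_mul_assoc, mul_smul_comm, map_smul, h]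

theorem iEltK_eq_monomialK (A : IndepSets n) : iEltK K A = monomialK K A.1.toList := by
  have h : iElt A = (A.1.toList.map (tlB (typeEMatrix n))).prod := by
    unfold iElt
    rw [Finset.noncommProd]
    have : A.1.val = (A.1.toList : Multiset (Fin n)) := (Finset.coe_toList _).symm
    simp only [this, Multiset.map_coe, Multiset.noncommProd_coe]
  rw [iEltK, monomialK, h]

end Scalars

/-! ### Periodic sequences of vertices with two neighbours in every gap -/

section Gaps

/-- The adjacency relation of `E_n`, on natural numbers. -/
def AdjE (i j : ℕ) : Prop :=
  (1 ≤ i ∧ i + 1 = j) ∨ (1 ≤ j ∧ j + 1 = i) ∨ (i = 0 ∧ j = 3) ∨ (i = 3 ∧ j = 0)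

/-- Whenever a letter that has a neighbour somewhere in the sequence `a` occurs twice, at least two
neighbours of it occur in between. -/
def TwoNeighboursInGaps (a : ℕ → ℕ) : Prop :=
  ∀ x y, x < y → a x = a y → (∃ m, AdjE (a m) (a x)) →
    ∃ r₁ r₂, x < r₁ ∧ r₁ < r₂ ∧ r₂ < y ∧ AdjE (a r₁) (a x) ∧ AdjE (a r₂) (a x)

/-- Between any two occurrences of `t` in the sequence `a` there is an occurrence of `s`. -/
def Separates (a : ℕ → ℕ) (s t : ℕ) : Prop :=
  ∀ x y, x < y → a x = t → a y = t → ∃ r, x < r ∧ r < y ∧ a r = s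

variable {a : ℕ → ℕ}

/-- If occurrences of `u` are separated by `s`, the neighbours of `s` in a gap cannot all be `u`:
of two occurrences of `u` in the gap, the `s` between them would end a shorter such gap. -/
theorem TwoNeighboursInGaps.exists_ne (H : TwoNeighboursInGaps a) {s u : ℕ}
    (hu : Separates a s u) (hs : ∃ m, AdjE (a m) s) :
    ∀ x y, x < y → a x = s → a y = s → ∃ r, x < r ∧ r < y ∧ AdjE (a r) s ∧ a r ≠ u := by
  intro x y
  induction y using Nat.strong_induction_on with
  | _ y ih =>
  intro hxy hx hy
  obtain ⟨r₁, r₂, h1, h2, h3, h4, h5⟩ := H x y hxy (hx.trans hy.symm) (hx ▸ hs)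
  rw [hx] at h4 h5
  by_cases e1 : a r₁ = u
  · by_cases e2 : a r₂ = u
    · obtain ⟨r, hr1, hr2, hr⟩ := hu r₁ r₂ h2 e1 e2
      obtain ⟨r', h6, h7, h8⟩ := ih r (by omega) (by omega) hx hr
      exact ⟨r', h6, by omega, h8⟩
    · exact ⟨r₂, by omega, h3, h5, e2⟩
  · exact ⟨r₁, h1, by omega, h4, e1⟩

variable {n p : ℕ}

/-- On the arm `4, …, n - 1`, occurrences of `i + 1` are separated by those of `i`. -/
theorem TwoNeighboursInGaps.separates_arm (H : TwoNeighboursInGaps a) (han : ∀ k, a k < n) :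
    ∀ d i, 3 ≤ i → i + d = n → (∃ k, a k = i) → Separates a i (i + 1) := by
  intro d
  induction d with
  | zero => intro i _ hd ⟨k, hk⟩; have := han k; omega
  | succ d ih =>
    intro i hi hd ⟨k, hk⟩ x y hxy hx hy
    have hadj : ∃ m, AdjE (a m) (i + 1) := ⟨k, by unfold AdjE; omega⟩
    obtain ⟨r, h1, h2, h3, h4⟩ := H.exists_ne (ih (i + 1) (by omega) (by omega) ⟨x, hx⟩) hadj x y
      hxy hx hy
    exact ⟨r, h1, h2, by unfold AdjE at h3; omega⟩

/-- Occurrences of `2` are separated by those of `3`. -/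
theorem TwoNeighboursInGaps.separates_two (H : TwoNeighboursInGaps a) (h3 : ∃ k, a k = 3) :
    Separates a 3 2 := by
  intro x y hxy hx hy
  obtain ⟨k, hk⟩ := h3
  have h21 : Separates a 2 1 := by
    intro x' y' hxy' hx' hy'
    obtain ⟨r₁, r₂, h1, h2, h3, h4, h5⟩ := H x' y' hxy' (hx'.trans hy'.symm)
      ⟨x, by unfold AdjE; omega⟩
    exact ⟨r₁, h1, by omega, by unfold AdjE at h4; omega⟩
  obtain ⟨r, h1, h2, h3, h4⟩ := H.exists_ne h21 ⟨k, by unfold AdjE; omega⟩ x y hxy hx hy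
  exact ⟨r, h1, h2, by unfold AdjE at h3; omega⟩

/-- In a periodic sequence, a letter that occurs recurs beyond any position. -/
theorem exists_next {α : Type*} {a : ℕ → α} {p : ℕ} (hp : 0 < p) (hper : ∀ k, a (k + p) = a k)
    (x : ℕ) : ∃ y, x < y ∧ a y = a x ∧ ∀ r, x < r → r < y → a r ≠ a x := by
  classical
  have h : ∃ y, x < y ∧ a y = a x := ⟨x + p, by omega, hper x⟩
  refine ⟨Nat.find h, (Nat.find_spec h).1, (Nat.find_spec h).2, fun r hr hr' he => ?_⟩
  exact Nat.find_min h hr' ⟨hr, he⟩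

theorem exists_prev {x x' : ℕ} (hx : x' < x) (h : a x' = a x) :
    ∃ y, y < x ∧ a y = a x ∧ ∀ r, y < r → r < x → a r ≠ a x := by
  induction hd : x - x' using Nat.strong_induction_on generalizing x' with
  | _ d ih =>
  by_cases hr : ∃ r, x' < r ∧ r < x ∧ a r = a x
  · obtain ⟨r, h1, h2, h3⟩ := hr
    exact ih (x - r) (by omega) h2 h3 rfl
  · push Not at hr
    exact ⟨x', hx, h, fun r h1 h2 => hr r h1 h2⟩

/-- Occurrences of `3` are separated by those of `4`. Otherwise some gap between consecutive
occurrences of `3` has exactly one `0` and one `2`; then the two gaps next to it have no `0` and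
hence a `2` each, and there are not enough occurrences of `2` between the occurrences of `1` that
these three occurrences of `2` require. -/
theorem TwoNeighboursInGaps.separates_three (H : TwoNeighboursInGaps a) (han : ∀ k, a k < n)
    (hn : 4 ≤ n) (hp : 0 < p) (hper : ∀ k, a (k + p) = a k) (h3 : ∃ m, AdjE (a m) 3) :
    Separates a 4 3 := by
  intro x y hxy hx hy
  have hex3 : ∃ k, a k = 3 := ⟨x, hx⟩
  have h43 : Separates a 3 4 := H.separates_arm han (n - 3) 3 le_rfl (by omega) hex3
  have h23 : Separates a 3 2 := H.separates_two hex3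
  have h03 : ∀ x' y', x' < y' → a x' = 0 → a y' = 0 →
      ∃ r₁ r₂, x' < r₁ ∧ r₁ < r₂ ∧ r₂ < y' ∧ a r₁ = 3 ∧ a r₂ = 3 := by
    intro x' y' hxy' hx' hy'
    obtain ⟨r₁, r₂, h1, h2, h3, h4, h5⟩ := H x' y' hxy' (hx'.trans hy'.symm)
      ⟨x, by unfold AdjE; omega⟩
    exact ⟨r₁, r₂, h1, h2, h3, by unfold AdjE at h4; omega, by unfold AdjE at h5; omega⟩
  -- shifting by a period makes room for one more gap on the left
  suffices h : ∃ r, x + p < r ∧ r < y + p ∧ a r = 4 by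
    obtain ⟨r, h1, h2, h4⟩ := h
    refine ⟨r - p, by omega, by omega, ?_⟩
    rw [← hper, Nat.sub_add_cancel (by omega), h4]
  by_contra hno
  push Not at hno
  have hx1 : a (x + p) = 3 := (hper x).trans hx
  have hy1 : a (y + p) = 3 := (hper y).trans hy
  obtain ⟨x₀, hx01, hx0, hx0'⟩ := exists_prev (a := a) (x := x + p) (x' := x) (by omega)
    (hper x).symm
  obtain ⟨x₂, hx12, hx2, hx2'⟩ := exists_next hp hper (x + p)
  obtain ⟨x₃, hx23, hx3, hx3'⟩ := exists_next hp hper x₂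
  rw [hx1] at hx0 hx0' hx2 hx2'
  rw [hx2] at hx3 hx3'
  set x₁ := x + p
  have hx2y : x₂ ≤ y + p := by
    by_contra hlt
    exact hx2' (y + p) (by omega) (by omega) hy1
  -- a gap between consecutive `3`s has at most one `2`; it has a `2`, or both a `0` and a `4`
  have huniq : ∀ l r, (∀ k, l < k → k < r → a k ≠ 3) → ∀ k k', l < k → k < r → l < k' → k' < r →
      a k = 2 → a k' = 2 → k = k' := by
    intro l r hlr k k' h1 h2 h3 h4 h5 h6
    rcases lt_trichotomy k k' with h | h | h
    · obtain ⟨q, hq1, hq2, hq⟩ := h23 k k' h h5 h6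
      exact absurd hq (hlr q (by omega) (by omega))
    · exact h
    · obtain ⟨q, hq1, hq2, hq⟩ := h23 k' k h h6 h5
      exact absurd hq (hlr q (by omega) (by omega))
  have hgap : ∀ l r, l < r → a l = 3 → a r = 3 → (∀ k, l < k → k < r → a k ≠ 3) →
      (∃ k, l < k ∧ k < r ∧ a k = 2) ∨
        ((∃ k, l < k ∧ k < r ∧ a k = 0) ∧ (∃ k, l < k ∧ k < r ∧ a k = 4)) := by
    intro l r hlr hl hr hne
    obtain ⟨r₁, r₂, h1, h2, h3, h4, h5⟩ := H l r hlr (hl.trans hr.symm) (hl ▸ h3)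
    rw [hl] at h4 h5
    have e1 : a r₁ = 0 ∨ a r₁ = 2 ∨ a r₁ = 4 := by unfold AdjE at h4; omega
    have e2 : a r₂ = 0 ∨ a r₂ = 2 ∨ a r₂ = 4 := by unfold AdjE at h5; omega
    rcases e1 with e1 | e1 | e1
    · rcases e2 with e2 | e2 | e2
      · obtain ⟨q, q', hq1, hq2, hq2', hq3, -⟩ := h03 r₁ r₂ h2 e1 e2
        exact absurd hq3 (hne q (by omega) (by omega))
      · exact Or.inl ⟨r₂, by omega, h3, e2⟩
      · exact Or.inr ⟨⟨r₁, h1, by omega, e1⟩, ⟨r₂, by omega, h3, e2⟩⟩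
    · exact Or.inl ⟨r₁, h1, by omega, e1⟩
    · rcases e2 with e2 | e2 | e2
      · exact Or.inr ⟨⟨r₂, by omega, h3, e2⟩, ⟨r₁, h1, by omega, e1⟩⟩
      · exact Or.inl ⟨r₂, by omega, h3, e2⟩
      · obtain ⟨q, hq1, hq2, hq3⟩ := h43 r₁ r₂ h2 e1 e2
        exact absurd hq3 (hne q (by omega) (by omega))
  -- the middle gap has no `4`, so it has a `2` and a `0`
  obtain ⟨p₁, hp1l, hp1r, hp1⟩ : ∃ k, x₁ < k ∧ k < x₂ ∧ a k = 2 := by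
    rcases hgap x₁ x₂ hx12 hx1 hx2 hx2' with h | ⟨-, k, h1, h2, h4⟩
    · exact h
    · exact absurd h4 (hno k h1 (by omega))
  obtain ⟨z, hzl, hzr, hz⟩ : ∃ k, x₁ < k ∧ k < x₂ ∧ a k = 0 := by
    obtain ⟨r₁, r₂, h1, h2, h3, h4, h5⟩ := H x₁ x₂ hx12 (hx1.trans hx2.symm) (hx1 ▸ h3)
    rw [hx1] at h4 h5
    have e1 := hno r₁ h1 (by omega)
    have e2 := hno r₂ (by omega) (by omega)
    by_cases e3 : a r₁ = 0
    · exact ⟨r₁, h1, by omega, e3⟩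
    · refine ⟨r₂, by omega, h3, ?_⟩
      by_contra e4
      have := huniq x₁ x₂ hx2' r₁ r₂ h1 (by omega) (by omega) h3
        (by unfold AdjE at h4; omega) (by unfold AdjE at h5; omega)
      omega
  obtain ⟨p₀, hp0l, hp0r, hp0⟩ : ∃ k, x₀ < k ∧ k < x₁ ∧ a k = 2 := by
    rcases hgap x₀ x₁ hx01 hx0 hx1 hx0' with h | ⟨⟨k, h1, h2, h0⟩, -⟩
    · exact h
    · obtain ⟨r₁, r₂, h4, h5, h6, h7, h8⟩ := h03 k z (by omega) h0 hz
      have e1 : r₁ = x₁ := by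
        by_contra hne
        rcases Nat.lt_or_gt_of_ne hne with h | h
        · exact hx0' r₁ (by omega) h h7
        · exact hx2' r₁ h (by omega) h7
      exact absurd h8 (hx2' r₂ (by omega) (by omega))
  obtain ⟨p₂, hp2l, hp2r, hp2⟩ : ∃ k, x₂ < k ∧ k < x₃ ∧ a k = 2 := by
    rcases hgap x₂ x₃ hx23 hx2 hx3 hx3' with h | ⟨⟨k, h1, h2, h0⟩, -⟩
    · exact h
    · obtain ⟨r₁, r₂, h4, h5, h6, h7, h8⟩ := h03 z k (by omega) hz h0
      have e1 : r₂ = x₂ := by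
        by_contra hne
        rcases Nat.lt_or_gt_of_ne hne with h | h
        · exact hx2' r₂ (by omega) h h8
        · exact hx3' r₂ h (by omega) h8
      exact absurd h7 (hx2' r₁ (by omega) (by omega))
  -- consecutive `2`s with only one `3` in between have a `1` in between
  have hone : ∀ l r m, l < r → a l = 2 → a r = 2 → (∀ k, l < k → k < r → a k = 3 → k = m) →
      ∃ k, l < k ∧ k < r ∧ a k = 1 := by
    intro l r m hlr hl hr hm
    obtain ⟨r₁, r₂, h1, h2, h3, h4, h5⟩ := H l r hlr (hl.trans hr.symm)
      ⟨x, by unfold AdjE; omega⟩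
    rw [hl] at h4 h5
    by_cases e1 : a r₁ = 3
    · by_cases e2 : a r₂ = 3
      · have := hm r₁ h1 (by omega) e1
        have := hm r₂ (by omega) h3 e2
        omega
      · exact ⟨r₂, by omega, h3, by unfold AdjE at h5; omega⟩
    · exact ⟨r₁, h1, by omega, by unfold AdjE at h4; omega⟩
  obtain ⟨q₁, hq1l, hq1r, hq1⟩ := hone p₀ p₁ x₁ (by omega) hp0 hp1 fun k h1 h2 hk => by
    by_contra hne
    rcases Nat.lt_or_gt_of_ne hne with h | h
    · exact hx0' k (by omega) h hk
    · exact hx2' k h (by omega) hk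
  obtain ⟨q₂, hq2l, hq2r, hq2⟩ := hone p₁ p₂ x₂ (by omega) hp1 hp2 fun k h1 h2 hk => by
    by_contra hne
    rcases Nat.lt_or_gt_of_ne hne with h | h
    · exact hx2' k (by omega) h hk
    · exact hx3' k h (by omega) hk
  -- so two `1`s have only `p₁` as an occurrence of `2` in between
  obtain ⟨r₁, r₂, h1, h2, h3, h4, h5⟩ := H q₁ q₂ (by omega) (hq1.trans hq2.symm)
    ⟨p₁, by unfold AdjE; omega⟩
  have key : ∀ k, p₀ < k → k < p₂ → a k = 2 → k = p₁ := by
    intro k hk1 hk2 hk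
    rcases lt_trichotomy k x₁ with h | h | h
    · have := huniq x₀ x₁ hx0' p₀ k hp0l hp0r (by omega) h hp0 hk
      omega
    · rw [h] at hk; omega
    rcases lt_trichotomy k x₂ with h' | h' | h'
    · exact huniq x₁ x₂ hx2' k p₁ h h' hp1l hp1r hk hp1
    · rw [h'] at hk; omega
    · have := huniq x₂ x₃ hx3' p₂ k hp2l hp2r h' (by omega) hp2 hk
      omega
  have e1 := key r₁ (by omega) (by omega) (by unfold AdjE at h4; omega)
  have e2 := key r₂ (by omega) (by omega) (by unfold AdjE at h5; omega)
  omega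

/-- A periodic sequence of vertices of `E_n` with two neighbours in every gap has no adjacent
letters at all. -/
theorem TwoNeighboursInGaps.not_adj (H : TwoNeighboursInGaps a) (han : ∀ k, a k < n)
    (hn : 4 ≤ n) (hp : 0 < p) (hper : ∀ k, a (k + p) = a k) (i j : ℕ) : ¬ AdjE (a i) (a j) := by
  -- propagate from `3` along the arm up to the leaf `n - 1`
  have main : (∃ k, a k = 3) → ¬ ∃ m, AdjE (a m) 3 := by
    rintro ⟨k₀, hk₀⟩ h3
    have step : ∀ d, (∃ k, a k = 3 + d) ∧ Separates a (3 + d + 1) (3 + d) := by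
      intro d
      induction d with
      | zero => exact ⟨⟨k₀, hk₀⟩, H.separates_three han hn hp hper h3⟩
      | succ d ih =>
        obtain ⟨⟨k, hk⟩, hsep⟩ := ih
        obtain ⟨r, -, -, hr⟩ := hsep k (k + p) (by omega) hk ((hper k).trans hk)
        refine ⟨⟨r, hr⟩, fun x y hxy hx hy => ?_⟩
        obtain ⟨q, hq1, hq2, hq3, hq4⟩ :=
          H.exists_ne hsep ⟨k, by unfold AdjE; omega⟩ x y hxy hx hy
        exact ⟨q, hq1, hq2, by unfold AdjE at hq3; omega⟩
    obtain ⟨⟨k, hk⟩, -⟩ := step n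
    have := han k
    omega
  have harm : ∀ d, (∃ k, a k = 3 + d) → ¬ ∃ k, a k = 3 + d + 1 := by
    intro d
    induction d with
    | zero => exact fun h ⟨k, hk⟩ => main h ⟨k, by unfold AdjE; omega⟩
    | succ d ih =>
      rintro ⟨k, hk⟩ ⟨m, hm⟩
      have hsep := H.separates_arm han (n - (3 + (d + 1))) (3 + (d + 1)) (by omega)
        (by have := han k; omega) ⟨k, hk⟩
      obtain ⟨r, -, -, h1, h2⟩ := H.exists_ne hsep ⟨m, by unfold AdjE; omega⟩ k (k + p) (by omega)
        hk ((hper k).trans hk)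
      exact ih ⟨r, by unfold AdjE at h1; omega⟩ ⟨k, hk⟩
  have h12 : ∀ k m, a k = 1 → a m = 2 → False := by
    intro k m hk hm
    have h21 : Separates a 2 1 := by
      intro x' y' hxy' hx' hy'
      obtain ⟨r₁, r₂, h1, h2, h3, h4, h5⟩ := H x' y' hxy' (hx'.trans hy'.symm)
        ⟨m, by unfold AdjE; omega⟩
      exact ⟨r₁, h1, by omega, by unfold AdjE at h4; omega⟩
    obtain ⟨r, -, -, h1, h2⟩ := H.exists_ne h21 ⟨k, by unfold AdjE; omega⟩ m (m + p) (by omega)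
      hm ((hper m).trans hm)
    exact main ⟨r, by unfold AdjE at h1; omega⟩ ⟨m, by unfold AdjE; omega⟩
  have hsucc : ∀ k m, 1 ≤ a k → a k + 1 ≠ a m := by
    intro k m h1 h2
    by_cases e1 : a k = 1
    · exact h12 k m e1 (by omega)
    by_cases e2 : a k = 2
    · exact main ⟨m, by omega⟩ ⟨k, by unfold AdjE; omega⟩
    · exact harm (a k - 3) ⟨k, by omega⟩ ⟨m, by omega⟩
  rintro (⟨h1, h2⟩ | ⟨h1, h2⟩ | ⟨h1, h2⟩ | ⟨h1, h2⟩)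
  · exact hsucc i j h1 h2
  · exact hsucc j i h1 h2
  · exact main ⟨j, h2⟩ ⟨i, by unfold AdjE; omega⟩
  · exact main ⟨i, h1⟩ ⟨j, by unfold AdjE; omega⟩

end Gaps

/-! ### A trace is determined by its values on the elements `i(A)` -/

section Uniqueness

variable {K : Type*} [Field K] [Algebra (LaurentPolynomial ℤ) K] {n : ℕ}

theorem monomialK_singleton_append_comm {s : Fin n} {u : List (Fin n)}
    (hu : ∀ t ∈ u, ¬ (typeEGraph n).Adj t s) :
    monomialK K ([s] ++ u) = monomialK K (u ++ [s]) := by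
  induction u with
  | nil => rfl
  | cons t u ih =>
    have h1 : [s] ++ t :: u = [s, t] ++ u := rfl
    have h2 : t :: u ++ [s] = [t] ++ (u ++ [s]) := rfl
    have h3 : [t, s] ++ u = [t] ++ ([s] ++ u) := rfl
    rw [h1, monomialK_append,
      monomialK_comm (K := K) fun h => hu t List.mem_cons_self h.symm, ← monomialK_append, h3,
      monomialK_append, ih fun r hr => hu r (List.mem_cons_of_mem _ hr), ← monomialK_append, h2]

theorem monomialK_gap_zero {s : Fin n} {u : List (Fin n)}
    (hu : ∀ t ∈ u, ¬ (typeEGraph n).Adj t s) :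
    monomialK K ([s] ++ u ++ [s]) = deltaK K • monomialK K (u ++ [s]) := by
  rw [monomialK_append, monomialK_singleton_append_comm hu, ← monomialK_append, List.append_assoc,
    List.singleton_append, monomialK_append, monomialK_pair, mul_smul_comm, ← monomialK_append]

theorem monomialK_gap_one {s t : Fin n} (hst : (typeEGraph n).Adj s t) {u u' : List (Fin n)}
    (hu : ∀ t ∈ u, ¬ (typeEGraph n).Adj t s) (hu' : ∀ t ∈ u', ¬ (typeEGraph n).Adj t s) :
    monomialK K ([s] ++ u ++ [t] ++ u' ++ [s]) = monomialK K (u ++ [s] ++ u') := by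
  rw [List.append_assoc, monomialK_append, ← monomialK_singleton_append_comm hu',
    monomialK_append (K := K) ([s] ++ u) [t], monomialK_singleton_append_comm hu,
    ← monomialK_append, ← monomialK_append]
  have h : u ++ [s] ++ [t] ++ ([s] ++ u') = u ++ [s, t, s] ++ u' := by simp
  rw [h, monomialK_append, monomialK_append, monomialK_triple hst, ← monomialK_append,
    ← monomialK_append]

theorem iEltK_eq_monomialK_of_nodup {w : List (Fin n)} (hw : w.Nodup) (A : IndepSets n)
    (hA : A.1 = w.toFinset) : iEltK K A = monomialK K w := by
  obtain ⟨A, hA'⟩ := A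
  subst hA
  rw [iEltK, monomialK, iElt]
  congr 1
  exact Finset.noncommProd_toFinset _ _ _ hw

/-- The stretch of length `l`, starting at position `i`, of a sequence of letters. -/
def stretch (a : ℕ → Fin n) (i l : ℕ) : List (Fin n) := (List.range' i l).map a

theorem length_stretch (a : ℕ → Fin n) (i l : ℕ) : (stretch a i l).length = l := by
  simp [stretch]

theorem stretch_add (a : ℕ → Fin n) (i k l : ℕ) :
    stretch a i (k + l) = stretch a i k ++ stretch a (i + k) l := by
  rw [stretch, stretch, stretch, ← List.map_append, List.range'_append_1]

theorem stretch_one (a : ℕ → Fin n) (i : ℕ) : stretch a i 1 = [a i] := rfl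

theorem mem_stretch {a : ℕ → Fin n} {i l : ℕ} {t : Fin n} (h : t ∈ stretch a i l) :
    ∃ r, i ≤ r ∧ r < i + l ∧ a r = t := by
  simp only [stretch, List.mem_map, List.mem_range'_1] at h
  obtain ⟨r, ⟨h1, h2⟩, h3⟩ := h
  exact ⟨r, h1, h2, h3⟩

theorem stretch_gap (a : ℕ → Fin n) {x y : ℕ} (h : x < y) :
    stretch a x (y + 1 - x) = [a x] ++ stretch a (x + 1) (y - x - 1) ++ [a y] := by
  have h1 : y + 1 - x = 1 + (y - x - 1) + 1 := by omega
  have h2 : x + (1 + (y - x - 1)) = y := by omega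
  rw [h1, stretch_add, stretch_add, stretch_one, stretch_one, h2]

theorem stretch_gap' (a : ℕ → Fin n) {x r y : ℕ} (h : x < r) (h' : r < y) :
    stretch a (x + 1) (y - x - 1) =
      stretch a (x + 1) (r - x - 1) ++ [a r] ++ stretch a (r + 1) (y - r - 1) := by
  have h1 : y - x - 1 = (r - x - 1) + 1 + (y - r - 1) := by omega
  have h2 : x + 1 + (r - x - 1) = r := by omega
  have h3 : x + 1 + (r - x - 1 + 1) = r + 1 := by omega
  rw [h1, stretch_add, stretch_add, stretch_one, h2, h3]

variable {τ : TLK K n →ₗ[K] K}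

/-- The value of a trace on one period of a periodic sequence does not depend on where the period
starts. -/
theorem trace_stretch (hτ : ∀ a b, τ (a * b) = τ (b * a)) {a : ℕ → Fin n} {p : ℕ}
    (hper : ∀ k, a (k + p) = a k) (i : ℕ) :
    τ (monomialK K (stretch a i p)) = τ (monomialK K (stretch a 0 p)) := by
  induction i with
  | zero => rfl
  | succ i ih =>
    rw [← ih]
    cases p with
    | zero => rfl
    | succ p =>
      have h1 : i + 1 + p = i + (p + 1) := by omega
      rw [stretch_add a (i + 1) p 1, monomialK_append, hτ, stretch_one, h1, hper, add_comm p 1,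
        stretch_add, monomialK_append, stretch_one]

/-- Consecutive occurrences of a letter, less than one period apart, have at least two
neighbours in between, as otherwise the monomial reduces to a shorter one. -/
theorem exists_two_neighbours_of_trace_ne_zero (hτ : ∀ a b, τ (a * b) = τ (b * a))
    {a : ℕ → Fin n} {p : ℕ} (hper : ∀ k, a (k + p) = a k)
    (hne : τ (monomialK K (stretch a 0 p)) ≠ 0)
    (hshort : ∀ w : List (Fin n), w.length < p → τ (monomialK K w) = 0)
    {x y : ℕ} (hxy : x < y) (hyp : y < x + p) (h : a y = a x) :
    ∃ r₁ r₂, x < r₁ ∧ r₁ < r₂ ∧ r₂ < y ∧ (typeEGraph n).Adj (a r₁) (a x) ∧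
      (typeEGraph n).Adj (a r₂) (a x) := by
  rw [← trace_stretch hτ hper x] at hne
  have hp : p = (y + 1 - x) + (x + p - (y + 1)) := by omega
  have h0 : x + (y + 1 - x) = y + 1 := by omega
  by_contra hno
  push Not at hno
  apply hne
  rw [hp, stretch_add, h0, stretch_gap a hxy, h]
  by_cases hr : ∃ r, x < r ∧ r < y ∧ (typeEGraph n).Adj (a r) (a x)
  · obtain ⟨r, h1, h2, h3⟩ := hr
    rw [stretch_gap' a h1 h2, ← List.append_assoc, ← List.append_assoc, monomialK_append,
      monomialK_gap_one h3.symm, ← monomialK_append]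
    · apply hshort
      simp only [List.length_append, length_stretch, List.length_singleton]
      omega
    · intro t ht hadj
      obtain ⟨q, h4, h5, rfl⟩ := mem_stretch ht
      exact hno q r (by omega) (by omega) h2 hadj h3
    · intro t ht hadj
      obtain ⟨q, h4, h5, rfl⟩ := mem_stretch ht
      exact hno r q h1 (by omega) (by omega) h3 hadj
  · push Not at hr
    rw [monomialK_append, monomialK_gap_zero, smul_mul_assoc, ← monomialK_append, map_smul,
      hshort, smul_zero]
    · simp only [List.length_append, length_stretch, List.length_singleton]
      omega
    · intro t ht hadj
      obtain ⟨q, h4, h5, rfl⟩ := mem_stretch ht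
      exact hr q (by omega) (by omega) hadj

/-- The analogue of the preceding lemma for the gap from an occurrence of a letter to its copy one
period later. Here the letter may occur only once, so gaps without neighbours are possible. -/
theorem exists_two_neighbours_of_trace_ne_zero' (hδ : deltaK K ≠ 0)
    (hτ : ∀ a b, τ (a * b) = τ (b * a))
    {a : ℕ → Fin n} {p : ℕ} (hp : 0 < p) (hper : ∀ k, a (k + p) = a k)
    (hne : τ (monomialK K (stretch a 0 p)) ≠ 0)
    (hshort : ∀ w : List (Fin n), w.length < p → τ (monomialK K w) = 0)
    {x m : ℕ} (hm : (typeEGraph n).Adj (a m) (a x)) :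
    ∃ r₁ r₂, x < r₁ ∧ r₁ < r₂ ∧ r₂ < x + p ∧ (typeEGraph n).Adj (a r₁) (a x) ∧
      (typeEGraph n).Adj (a r₂) (a x) := by
  rw [← trace_stretch hτ hper x] at hne
  -- move the occurrence of the neighbour into the period that starts at `x`
  obtain ⟨r, h1, h2, h3⟩ : ∃ r, x < r ∧ r < x + p ∧ (typeEGraph n).Adj (a r) (a x) := by
    have hmod : ∀ k, a (k % p) = a k := fun k => by
      have : Function.Periodic a p := hper
      exact this.map_mod_nat k
    have h1 := Nat.mod_lt (m + x * p - x) hp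
    have hxp : x ≤ x * p := Nat.le_mul_of_pos_right x hp
    have h2 : a (x + (m + x * p - x) % p) = a m := by
      rw [← hmod, Nat.add_mod_mod, hmod]
      have h3 : x + (m + x * p - x) = m + x * p := by omega
      rw [h3, ← hmod, Nat.add_mul_mod_self_right, hmod]
    refine ⟨x + (m + x * p - x) % p, ?_, by omega, h2 ▸ hm⟩
    rcases Nat.eq_zero_or_pos ((m + x * p - x) % p) with h0 | h0
    · rw [h0, add_zero] at h2
      rw [h2] at hm
      exact absurd hm ((typeEGraph n).irrefl)
    · omega
  by_contra hno
  push Not at hno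
  apply hne
  have h4 : p = (x + p - 1 + 1 - x) := by omega
  have hp1 : stretch a x p = [a x] ++ (stretch a (x + 1) (r - x - 1) ++ [a r] ++
      stretch a (r + 1) (x + p - r - 1)) := by
    rw [← stretch_gap' a h1 h2]
    have : p = 1 + (x + p - x - 1) := by omega
    nth_rewrite 1 [this]
    rw [stretch_add, stretch_one]
  -- duplicate the letter `a x` at the cost of a factor `δ`, and rotate the copy to the end
  have key : deltaK K * τ (monomialK K (stretch a x p)) = 0 := by
    rw [hp1, monomialK_append, ← smul_eq_mul, ← map_smul, ← smul_mul_assoc, ← monomialK_pair,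
      ← monomialK_append]
    set u := stretch a (x + 1) (r - x - 1) ++ [a r] ++ stretch a (r + 1) (x + p - r - 1) with hu
    have h5 : [a x, a x] ++ u = [a x] ++ ([a x] ++ u) := rfl
    rw [h5, monomialK_append, hτ, ← monomialK_append, hu, ← List.append_assoc, ← List.append_assoc,
      monomialK_gap_one h3.symm]
    · apply hshort
      simp only [List.length_append, length_stretch, List.length_singleton]
      omega
    · intro t ht hadj
      obtain ⟨q, h4, h5, rfl⟩ := mem_stretch ht
      exact hno q r (by omega) (by omega) h2 hadj h3
    · intro t ht hadj
      obtain ⟨q, h4, h5, rfl⟩ := mem_stretch ht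
      exact hno r q h1 (by omega) (by omega) h3 hadj
  exact (mul_eq_zero.1 key).resolve_left hδ

/-- A trace that vanishes on all elements `i(A)` is zero. -/
theorem trace_eq_zero (hn : 4 ≤ n) (hδ : deltaK K ≠ 0) (hτ : ∀ a b, τ (a * b) = τ (b * a))
    (hA : ∀ A : IndepSets n, τ (iEltK K A) = 0) : τ = 0 := by
  refine linearMap_ext_monomialK fun w => ?_
  rw [LinearMap.zero_apply]
  induction hp : w.length using Nat.strong_induction_on generalizing w with
  | _ p ih =>
  have hshort : ∀ u : List (Fin n), u.length < p → τ (monomialK K u) = 0 :=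
    fun u hu => ih u.length hu u rfl
  by_contra hne
  rcases Nat.eq_zero_or_pos p with hp0 | hp0
  · have hw : w = [] := List.length_eq_zero_iff.1 (hp.trans hp0)
    apply hne
    rw [hw, ← iEltK_eq_monomialK_of_nodup List.nodup_nil ⟨∅, by simp⟩ rfl, hA]
  let a : ℕ → Fin n := fun k => w[k % p]'(hp.symm ▸ Nat.mod_lt k hp0)
  have hper : ∀ k, a (k + p) = a k := fun k => by simp [a]
  have hw : stretch a 0 p = w := by
    refine List.ext_getElem (by simp [stretch, hp]) fun i h1 h2 => ?_
    have : i % p = i := Nat.mod_eq_of_lt (hp ▸ h2)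
    simp [stretch, a, this]
  rw [← hw] at hne
  have hgap : TwoNeighboursInGaps fun k => (a k).val := by
    rintro x y hxy h ⟨m, hm⟩
    obtain ⟨z, h1, h2, h3⟩ := exists_next hp0 hper x
    have hzy : z ≤ y := by
      by_contra hlt
      exact h3 y hxy (by omega) (Fin.ext h.symm)
    have hzp : z ≤ x + p := by
      by_contra hlt
      exact h3 (x + p) (by omega) (by omega) (hper x)
    rcases Nat.lt_or_eq_of_le hzp with hlt | heq
    · obtain ⟨r₁, r₂, h4, h5, h6, h7⟩ :=
        exists_two_neighbours_of_trace_ne_zero hτ hper hne hshort h1 hlt h2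
      exact ⟨r₁, r₂, h4, h5, by omega, h7⟩
    · obtain ⟨r₁, r₂, h4, h5, h6, h7⟩ :=
        exists_two_neighbours_of_trace_ne_zero' hδ hτ hp0 hper hne hshort (x := x) (m := m) hm
      exact ⟨r₁, r₂, h4, h5, by omega, h7⟩
  have hadj : ∀ i j, ¬ (typeEGraph n).Adj (a i) (a j) :=
    hgap.not_adj (fun k => (a k).isLt) hn hp0 (fun k => congrArg Fin.val (hper k))
  have hnodup : w.Nodup := by
    rw [List.nodup_iff_injective_getElem]
    intro i j hij
    by_contra hne'
    wlog hlt : i < j generalizing i j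
    · exact this hij.symm (Ne.symm hne') (lt_of_le_of_ne (not_lt.1 hlt) (Ne.symm hne'))
    have hi : a i = w[i] := by
      have : i.val % p = i.val := Nat.mod_eq_of_lt (by have := i.isLt; omega)
      simp [a, this]
    have hj : a j = w[j] := by
      have : j.val % p = j.val := Nat.mod_eq_of_lt (by have := j.isLt; omega)
      simp [a, this]
    obtain ⟨r₁, -, -, -, -, h, -⟩ := exists_two_neighbours_of_trace_ne_zero hτ hper hne hshort
      (x := i) (y := j) hlt (by have := j.isLt; omega) (by rw [hi, hj]; exact hij.symm)
    exact hadj _ _ h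
  have hmem : ∀ s ∈ w, ∃ k, a k = s := by
    intro s hs
    rw [← hw] at hs
    obtain ⟨r, -, -, h⟩ := mem_stretch hs
    exact ⟨r, h⟩
  have hind : (typeEGraph n).IsIndepSet ((w.toFinset : Finset (Fin n)) : Set (Fin n)) := by
    intro s hs t ht _
    obtain ⟨i, rfl⟩ := hmem s (by simpa using hs)
    obtain ⟨j, rfl⟩ := hmem t (by simpa using ht)
    exact hadj i j
  apply hne
  rw [hw, ← iEltK_eq_monomialK_of_nodup hnodup ⟨_, hind⟩ rfl, hA]

/-- A trace is determined by its values on the elements `i(A)`. -/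
theorem trace_ext (hn : 4 ≤ n) (hδ : deltaK K ≠ 0) {σ τ : TLK K n →ₗ[K] K}
    (hσ : ∀ a b, σ (a * b) = σ (b * a)) (hτ : ∀ a b, τ (a * b) = τ (b * a))
    (h : ∀ A : IndepSets n, σ (iEltK K A) = τ (iEltK K A)) : σ = τ := by
  rw [← sub_eq_zero]
  refine trace_eq_zero hn hδ (fun a b => ?_) fun A => ?_
  · rw [LinearMap.sub_apply, LinearMap.sub_apply, hσ, hτ]
  · rw [LinearMap.sub_apply, h, sub_self]

end Uniqueness

/-! ### The equivalence classes of sets of pairwise non-adjacent vertices -/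

section Classes

variable {n : ℕ}

/-- Replacing a vertex `s` of an independent set by an adjacent vertex `t` none of whose other
neighbours is in the set yields a neighbouring independent set. -/
theorem exists_neighbours_move (A : IndepSets n) {s t : Fin n} (hs : s ∈ A.1)
    (hst : (typeEGraph n).Adj s t) (ht : ∀ r ∈ A.1, (typeEGraph n).Adj r t → r = s) :
    ∃ B : IndepSets n, B.1 = insert t (A.1.erase s) ∧ Neighbours A B := by
  have htA : t ∉ A.1 := fun h => A.2 hs h hst.ne hst
  have hne : s ≠ t := hst.ne
  have hind : (typeEGraph n).IsIndepSet ((insert t (A.1.erase s) : Finset (Fin n)) :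
      Set (Fin n)) := by
    have h : ∀ r ∈ A.1.erase s, ¬ (typeEGraph n).Adj r t := fun r hr hadj =>
      Finset.ne_of_mem_erase hr (ht r (Finset.mem_of_mem_erase hr) hadj)
    intro x hx y hy hxy hadj
    rw [Finset.mem_coe, Finset.mem_insert] at hx hy
    rcases hx with rfl | hx <;> rcases hy with rfl | hy
    · exact hxy rfl
    · exact h y hy hadj.symm
    · exact h x hx hadj
    · exact A.2 (Finset.mem_of_mem_erase hx) (Finset.mem_of_mem_erase hy) hxy hadj
  refine ⟨⟨_, hind⟩, rfl, ?_, ?_, s, t, ?_, hst⟩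
  · have : A.1 ∩ insert t (A.1.erase s) = A.1.erase s := by
      ext x
      simp only [Finset.mem_inter, Finset.mem_insert, Finset.mem_erase]
      constructor
      · rintro ⟨h1, rfl | h2⟩
        · exact absurd h1 htA
        · exact h2
      · exact fun h => ⟨h.2, Or.inr h⟩
    rw [this, add_comm, Finset.card_erase_add_one hs]
  · rw [Finset.card_insert_of_notMem fun h => htA (Finset.mem_of_mem_erase h),
      Finset.card_erase_add_one hs]
  · ext x
    simp only [Finset.mem_sdiff, Finset.mem_union, Finset.mem_inter, Finset.mem_insert,
      Finset.mem_erase, Finset.mem_singleton]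
    by_cases h1 : x = s
    · subst h1; simp [hs, hne]
    by_cases h2 : x = t
    · subst h2; simp [htA]
    · simp [h1, h2]

/-- The sets whose elements other than `0` are packed towards the leaf `n - 1`, that is, of the form
`{j, j + 2, …, n - 1}`, and in which `0`, if present, is blocked by `4`. -/
structure IsPacked (A : Finset (Fin n)) : Prop where
  add_two_mem : ∀ i ∈ A, 1 ≤ i.val → i.val + 1 < n → ∃ j ∈ A, j.val = i.val + 2
  four_mem : ∀ i ∈ A, i.val = 0 → ∃ j ∈ A, j.val = 4

/-- A weight on independent sets that grows when vertices are moved towards the leaf `n - 1`. -/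
def weight (A : Finset (Fin n)) : ℕ := ∑ i ∈ A, max i.val 1

theorem weight_le (A : Finset (Fin n)) : weight A ≤ n * n := by
  have h1 : weight A ≤ A.card * n :=
    Finset.sum_le_card_nsmul A _ n fun i _ => by have := i.isLt; omega
  have h2 : A.card ≤ n := by simpa using Finset.card_le_univ A
  exact h1.trans (Nat.mul_le_mul_right n h2)

theorem weight_move {A : Finset (Fin n)} {s t : Fin n} (hs : s ∈ A) (ht : t ∉ A) :
    weight (insert t (A.erase s)) + max s.val 1 = weight A + max t.val 1 := by
  unfold weight
  rw [Finset.sum_insert fun h => ht (Finset.mem_of_mem_erase h), ← Finset.add_sum_erase A _ hs]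
  omega

/-- An independent set that is not packed is equivalent to one of larger weight. -/
theorem exists_weight_lt (hn : 6 ≤ n) (A : IndepSets n) (hA : ¬ IsPacked A.1) :
    ∃ B : IndepSets n, classOf B = classOf A ∧ weight A.1 < weight B.1 := by
  have hclass : ∀ {B C : IndepSets n}, Neighbours B C → classOf C = classOf B := fun h =>
    Quotient.sound (Relation.ReflTransGen.single h.symm)
  -- a single move
  have hmove : ∀ s t : Fin n, s ∈ A.1 → (typeEGraph n).Adj s t →
      (∀ r ∈ A.1, (typeEGraph n).Adj r t → r = s) → max s.val 1 < max t.val 1 →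
      ∃ B : IndepSets n, classOf B = classOf A ∧ weight A.1 < weight B.1 := by
    intro s t hs hst ht hlt
    obtain ⟨B, hB, hAB⟩ := exists_neighbours_move A hs hst ht
    have htA : t ∉ A.1 := fun h => A.2 hs h hst.ne hst
    have := weight_move hs htA
    rw [← hB] at this
    exact ⟨B, hclass hAB, by omega⟩
  by_cases h4 : ∃ j ∈ A.1, j.val = 4
  · have hA' : ∃ i ∈ A.1, 1 ≤ i.val ∧ i.val + 1 < n ∧ ∀ j ∈ A.1, j.val ≠ i.val + 2 := by
      by_contra hno
      push Not at hno
      exact hA ⟨hno, fun _ _ _ => h4⟩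
    obtain ⟨i, hi, h1, h2, h3⟩ := hA'
    refine hmove i ⟨i.val + 1, h2⟩ hi (Or.inl ⟨h1, rfl⟩) (fun r hr hadj => Fin.ext ?_) ?_
    · have h5 := h3 r hr
      rcases hadj with h | h | h | h
      · simp only at h; omega
      · simp only at h; omega
      · obtain ⟨j, hj, hj4⟩ := h4
        have := h3 j hj
        simp only at h; omega
      · simp only at h; omega
    · simp only; omega
  · push Not at h4
    by_cases h0 : ∃ i ∈ A.1, i.val = 0
    · obtain ⟨i, hi, hi0⟩ := h0
      let three : Fin n := ⟨3, by omega⟩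
      by_cases h2 : ∃ j ∈ A.1, j.val = 2
      · -- `2` is blocked by `0` and vice versa: move `2` to `1` and then `0` to `3`
        obtain ⟨j, hj, hj2⟩ := h2
        let one : Fin n := ⟨1, by omega⟩
        have hj1 : (typeEGraph n).Adj j one := Or.inr (Or.inl ⟨le_rfl, hj2.symm⟩)
        obtain ⟨B, hB, hAB⟩ := exists_neighbours_move A hj hj1 fun r hr hadj => by
          rcases hadj with h | h | h | h <;> simp only [one] at h <;> apply Fin.ext <;> omega
        have h1A : one ∉ A.1 := fun h => A.2 hj h hj1.ne hj1
        have hiB : i ∈ B.1 := by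
          rw [hB]
          refine Finset.mem_insert_of_mem (Finset.mem_erase.2 ⟨fun h => ?_, hi⟩)
          rw [h] at hi0; omega
        have hi3 : (typeEGraph n).Adj i three := Or.inr (Or.inr (Or.inl ⟨hi0, rfl⟩))
        obtain ⟨C, hC, hBC⟩ := exists_neighbours_move B hiB hi3 fun r hr hadj => by
          rw [hB, Finset.mem_insert, Finset.mem_erase] at hr
          have h2 : r.val ≠ 2 ∧ r.val ≠ 4 := by
            rcases hr with rfl | ⟨h2, h3⟩
            · simp [one]
            · exact ⟨fun h => h2 (Fin.ext (h.trans hj2.symm)), h4 r h3⟩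
          rcases hadj with h | h | h | h <;> simp only [three] at h <;> apply Fin.ext <;> omega
        have h3B : three ∉ B.1 := fun h => B.2 hiB h hi3.ne hi3
        have e1 := weight_move hj h1A
        have e2 := weight_move hiB h3B
        rw [← hB] at e1
        rw [← hC] at e2
        refine ⟨C, (hclass hBC).trans (hclass hAB), ?_⟩
        simp only [one, three] at e1 e2
        omega
      · push Not at h2
        refine hmove i three hi (Or.inr (Or.inr (Or.inl ⟨hi0, rfl⟩))) (fun r hr hadj => ?_)
          (by simp only [three]; omega)
        have e1 := h2 r hr
        have e2 := h4 r hr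
        rcases hadj with h | h | h | h <;> simp only [three] at h <;> apply Fin.ext <;> omega
    · push Not at h0
      have hA' : ∃ i ∈ A.1, 1 ≤ i.val ∧ i.val + 1 < n ∧ ∀ j ∈ A.1, j.val ≠ i.val + 2 := by
        by_contra hno
        push Not at hno
        exact hA ⟨hno, fun i hi hi0 => absurd hi0 (h0 i hi)⟩
      obtain ⟨i, hi, h1, h2, h3⟩ := hA'
      refine hmove i ⟨i.val + 1, h2⟩ hi (Or.inl ⟨h1, rfl⟩) (fun r hr hadj => Fin.ext ?_) ?_
      · have h5 := h3 r hr
        have h6 := h0 r hr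
        rcases hadj with h | h | h | h <;> simp only at h <;> omega
      · simp only; omega

/-- Every class contains a packed set. -/
theorem exists_isPacked (hn : 6 ≤ n) (A : IndepSets n) :
    ∃ T : IndepSets n, classOf T = classOf A ∧ IsPacked T.1 := by
  induction hd : n * n - weight A.1 using Nat.strong_induction_on generalizing A with
  | _ d ih =>
  by_cases hA : IsPacked A.1
  · exact ⟨A, rfl, hA⟩
  · obtain ⟨B, hBA, hlt⟩ := exists_weight_lt hn A hA
    have := weight_le B.1
    obtain ⟨T, hT, hTp⟩ := ih (n * n - weight B.1) (by omega) B rfl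
    exact ⟨T, hT.trans hBA, hTp⟩

theorem IsPacked.mem_of_le {A : Finset (Fin n)} (hA : IsPacked A) :
    ∀ d (i j : Fin n), i ∈ A → 1 ≤ i.val → j.val = i.val + 2 * d → j ∈ A := by
  intro d
  induction d with
  | zero =>
    intro i j hi _ hj
    rwa [Fin.ext hj]
  | succ d ih =>
    intro i j hi h1 hj
    obtain ⟨k, hk, hki⟩ := hA.add_two_mem i hi h1 (by have := j.isLt; omega)
    exact ih k j hk (by omega) (by omega)

theorem IsPacked.even_sub {A : Finset (Fin n)} (hA : IsPacked A) :
    ∀ d (i : Fin n), i ∈ A → 1 ≤ i.val → n - 1 - i.val = d → d % 2 = 0 := by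
  intro d
  induction d using Nat.strong_induction_on with
  | _ d ih =>
    intro i hi h1 hd
    by_cases h : i.val + 1 < n
    · obtain ⟨k, hk, hki⟩ := hA.add_two_mem i hi h1 h
      have := k.isLt
      have := ih (d - 2) (by omega) k hk (by omega) (by omega)
      omega
    · omega

variable (n) in
/-- The set `{0, 4, 6, 8, …}` of vertices. For odd `n` all vertices have an even number of
neighbours in it, and none of its elements can be moved. -/
def evenSet : Finset (Fin n) := {i | i.val = 0 ∨ (4 ≤ i.val ∧ i.val % 2 = 0)}

/-- A packed set is determined by its size and, for odd `n`, by whether it contains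
`{0, 4, 6, …, n - 1}`. -/
theorem IsPacked.eq_of_card_eq {A B : Finset (Fin n)} (hA : IsPacked A)
    (hB : IsPacked B) (hcard : A.card = B.card)
    (hodd : n % 2 = 1 → (evenSet n ⊆ A ↔ evenSet n ⊆ B)) : A = B := by
  -- a packed set that contains `0` contains `{0, 4, 6, …}`
  have hzero : ∀ {C D : Finset (Fin n)}, IsPacked C →
      (n % 2 = 1 → (evenSet n ⊆ C ↔ evenSet n ⊆ D)) → ∀ i : Fin n, i.val = 0 → i ∈ C → i ∈ D := by
    intro C D hC hCD i hi hiC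
    obtain ⟨j, hj, hj4⟩ := hC.four_mem i hiC hi
    have hn2 := hC.even_sub _ j hj (by omega) rfl
    refine (hCD (by have := j.isLt; omega)).1 (fun k hk => ?_) (by simp [evenSet, hi])
    simp only [evenSet, Finset.mem_filter, Finset.mem_univ, true_and] at hk
    rcases hk with hk | hk
    · rwa [Fin.ext (hk.trans hi.symm)]
    · exact hC.mem_of_le ((k.val - 4) / 2) j k hj (by omega) (by omega)
  by_cases hsub : A ⊆ B
  · exact Finset.eq_of_subset_of_card_le hsub hcard.ge
  · symm
    refine Finset.eq_of_subset_of_card_le (fun j hj => ?_) hcard.le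
    obtain ⟨i, hiA, hiB⟩ := Finset.not_subset.1 hsub
    by_cases hj0 : j.val = 0
    · exact hzero hB (fun h => (hodd h).symm) j hj0 hj
    have hi0 : i.val ≠ 0 := fun h => hiB (hzero hA hodd i h hiA)
    have e1 := hA.even_sub _ i hiA (by omega) rfl
    have e2 := hB.even_sub _ j hj (by omega) rfl
    have := i.isLt
    have := j.isLt
    rcases Nat.lt_or_ge i.val j.val with h | h
    · exact hA.mem_of_le ((j.val - i.val) / 2) i j hiA (by omega) (by omega)
    · exact absurd (hB.mem_of_le ((i.val - j.val) / 2) j i hj (by omega) (by omega)) hiB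

end Classes

/-! ### Anticommuting involutions attached to a graph -/

section Clifford

open Finset

theorem one_add_mul_self_of_sq {R : Type*} [Ring R] {g : R} (hg : g * g = 1) :
    (1 + g) * (1 + g) = 2 * (1 + g) := by
  rw [two_mul]
  simp only [mul_add, add_mul, hg, one_mul, mul_one]
  abel

theorem one_add_mul_mul_of_anticomm {R : Type*} [Ring R] {g h : R} (hg : g * g = 1)
    (hgh : h * g = -(g * h)) : (1 + g) * (1 + h) * (1 + g) = 2 * (1 + g) := by
  have h1 : g * h * g = -h := by rw [mul_assoc, hgh, mul_neg, ← mul_assoc, hg, one_mul]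
  rw [two_mul]
  simp only [mul_add, add_mul, hg, hgh, h1, one_mul, mul_one]
  abel

variable {V : Type*} [LinearOrder V] (G : SimpleGraph V) [DecidableRel G.Adj]

/-- The sign `-1` if `u < s` are adjacent, and `1` otherwise. The order serves to have exactly one
of the signs of `(s, t)` and `(t, s)` negative for adjacent `s` and `t`. -/
def pairSign (s u : V) : ℤ := if G.Adj u s ∧ u < s then -1 else 1

/-- The sign by which `g_s` acts on the basis vector indexed by `X`. -/
def edgeSign (s : V) (X : Finset V) : ℤ := ∏ u ∈ X, pairSign G s u

theorem pairSign_mul_self (s u : V) : pairSign G s u * pairSign G s u = 1 := by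
  unfold pairSign; split_ifs <;> rfl

theorem edgeSign_mul_self (s : V) (X : Finset V) : edgeSign G s X * edgeSign G s X = 1 := by
  rw [edgeSign, ← Finset.prod_mul_distrib]
  exact Finset.prod_eq_one fun u _ => pairSign_mul_self G s u

theorem edgeSign_symmDiff (s t : V) (X : Finset V) :
    edgeSign G s (symmDiff X {t}) = edgeSign G s X * pairSign G s t := by
  unfold edgeSign
  by_cases ht : t ∈ X
  · have h : symmDiff X {t} = X.erase t := by
      ext x; simp only [mem_symmDiff, mem_singleton, mem_erase]
      by_cases hx : x = t <;> simp [hx, ht]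
    rw [h, ← Finset.prod_erase_mul X _ ht, mul_assoc, pairSign_mul_self, mul_one]
  · have h : symmDiff X {t} = insert t X := by
      ext x; simp only [mem_symmDiff, mem_singleton, mem_insert]
      by_cases hx : x = t <;> simp [hx, ht]
    rw [h, Finset.prod_insert ht, mul_comm]

/-- The matrix of the operator `g_s` on the free module with basis the subsets of `V`, which sends
the subset `X` to `±(X ∆ {s})`. These operators are involutions; `g_s` and `g_t` anticommute if
`s` and `t` are adjacent and commute otherwise. -/
def cliff (s : V) : Matrix (Finset V) (Finset V) ℤ :=
  Matrix.of fun X Y => if Y = symmDiff X {s} then edgeSign G s X else 0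

variable [Fintype V]

theorem cliff_mul_apply (s : V) (M : Matrix (Finset V) (Finset V) ℤ) (X Y : Finset V) :
    (cliff G s * M) X Y = edgeSign G s X * M (symmDiff X {s}) Y := by
  simp [cliff, Matrix.mul_apply]

theorem cliff_mul_self (s : V) : cliff G s * cliff G s = 1 := by
  rw [← mul_one (cliff G s * cliff G s), mul_assoc]
  ext X Y
  rw [cliff_mul_apply, cliff_mul_apply, edgeSign_symmDiff, symmDiff_symmDiff_cancel_right,
    ← mul_assoc, ← mul_assoc, edgeSign_mul_self, one_mul]
  simp [pairSign]

theorem cliff_mul_cliff_apply (s t : V) (X Y : Finset V) :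
    (cliff G s * cliff G t) X Y =
      edgeSign G s X * edgeSign G t X * pairSign G t s *
        (1 : Matrix (Finset V) (Finset V) ℤ) (symmDiff (symmDiff X {s}) {t}) Y := by
  rw [← mul_one (cliff G s * cliff G t), mul_assoc, cliff_mul_apply, cliff_mul_apply,
    edgeSign_symmDiff]
  ring

theorem cliff_comm {s t : V} (h : ¬ G.Adj s t) : cliff G s * cliff G t = cliff G t * cliff G s := by
  ext X Y
  rw [cliff_mul_cliff_apply, cliff_mul_cliff_apply, symmDiff_right_comm]
  have h' : ¬ G.Adj t s := fun h' => h h'.symm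
  simp [pairSign, h, h', mul_comm]

theorem cliff_anticomm {s t : V} (h : G.Adj s t) :
    cliff G s * cliff G t = -(cliff G t * cliff G s) := by
  ext X Y
  rw [Matrix.neg_apply, cliff_mul_cliff_apply, cliff_mul_cliff_apply, symmDiff_right_comm]
  rcases lt_or_gt_of_ne h.ne with hlt | hlt
  · simp [pairSign, h, h.symm, hlt, hlt.le, mul_comm]
  · simp [pairSign, h, h.symm, hlt, hlt.le, mul_comm]

/-- The product of the elements `1 + g_s` along a word. -/
def cliffWord (w : List V) : Matrix (Finset V) (Finset V) ℤ :=
  (w.map fun s => 1 + cliff G s).prod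

theorem cliffWord_append (u w : List V) :
    cliffWord G (u ++ w) = cliffWord G u * cliffWord G w := by
  simp [cliffWord]

theorem cliffWord_cons (s : V) (w : List V) :
    cliffWord G (s :: w) = (1 + cliff G s) * cliffWord G w := by
  simp [cliffWord]

theorem cliffWord_singleton (s : V) : cliffWord G [s] = 1 + cliff G s := by
  simp [cliffWord]

theorem cliffWord_sq (x y : List V) (s : V) :
    cliffWord G (x ++ [s, s] ++ y) = 2 * cliffWord G (x ++ [s] ++ y) := by
  have h : cliffWord G [s, s] = 2 * cliffWord G [s] := by
    rw [cliffWord_cons, cliffWord_singleton, one_add_mul_self_of_sq (cliff_mul_self G s)]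
  simp only [cliffWord_append, h, two_mul, mul_add, add_mul]

theorem cliffWord_adj (x y : List V) {s t : V} (hst : G.Adj s t) :
    cliffWord G (x ++ [s, t, s] ++ y) = 2 * cliffWord G (x ++ [s] ++ y) := by
  have h : cliffWord G [s, t, s] = 2 * cliffWord G [s] := by
    rw [cliffWord_cons, cliffWord_cons, cliffWord_singleton, ← mul_assoc,
      one_add_mul_mul_of_anticomm (cliff_mul_self G s) (cliff_anticomm G hst.symm)]
  simp only [cliffWord_append, h, two_mul, mul_add, add_mul]

theorem cliff_commute_one_add {s t : V} (h : ¬ G.Adj s t) :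
    Commute (cliff G s) (1 + cliff G t) :=
  (Commute.one_right _).add_right (cliff_comm G h)

theorem cliffWord_comm (x y : List V) {s t : V} (hst : ¬ G.Adj s t) :
    cliffWord G (x ++ [s, t] ++ y) = cliffWord G (x ++ [t, s] ++ y) := by
  have h : cliffWord G [s, t] = cliffWord G [t, s] := by
    simp only [cliffWord, List.map_cons, List.map_nil, List.prod_cons, List.prod_nil, mul_one]
    exact ((Commute.one_left _).add_left (cliff_commute_one_add G hst)).eq
  simp only [cliffWord_append, h]

/-- The product along `w` changes a subset only by elements of `w`. -/
theorem cliffWord_apply_eq_zero {w : List V} : ∀ {X Y : Finset V},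
    ¬ symmDiff X Y ⊆ w.toFinset → cliffWord G w X Y = 0 := by
  induction w with
  | nil =>
    intro X Y h
    have hne : X ≠ Y := fun he => h (by simp [he])
    simp [cliffWord, hne]
  | cons s w ih =>
    intro X Y h
    rw [cliffWord_cons, add_mul, one_mul, Matrix.add_apply, cliff_mul_apply]
    rw [List.toFinset_cons] at h
    rw [ih, ih, mul_zero, add_zero]
    · intro h'
      apply h
      intro x hx
      by_cases hxs : x = s
      · simp [hxs]
      · refine mem_insert_of_mem (h' ?_)
        simp only [mem_symmDiff, mem_singleton] at hx ⊢
        simp only [hxs]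
        tauto
    · exact fun h' => h (h'.trans (subset_insert _ _))

theorem cliffWord_apply_self {w : List V} (hw : w.Nodup) (X : Finset V) :
    cliffWord G w X X = 1 := by
  induction w with
  | nil => simp [cliffWord]
  | cons s w ih =>
    rw [List.nodup_cons] at hw
    rw [cliffWord_cons, add_mul, one_mul, Matrix.add_apply, cliff_mul_apply, ih hw.2,
      cliffWord_apply_eq_zero, mul_zero, add_zero]
    rw [symmDiff_comm X, symmDiff_symmDiff_cancel_right, singleton_subset_iff, List.mem_toFinset]
    exact hw.1

theorem trace_cliffWord {w : List V} (hw : w.Nodup) :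
    (cliffWord G w).trace = 2 ^ Fintype.card V := by
  simp [Matrix.trace, cliffWord_apply_self G hw]

theorem cliff_commute_cliffWord {s : V} {w : List V} (h : ∀ t ∈ w, ¬ G.Adj s t) :
    Commute (cliff G s) (cliffWord G w) := by
  refine Commute.list_prod_right _ _ fun x hx => ?_
  obtain ⟨t, ht, rfl⟩ := List.mem_map.1 hx
  exact cliff_commute_one_add G (h t ht)

/-- On words of pairwise non-adjacent letters, squaring multiplies by a power of `2`. -/
theorem cliffWord_mul_self {w : List V} (hw : ∀ s ∈ w, ∀ t ∈ w, ¬ G.Adj s t) :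
    cliffWord G w * cliffWord G w = (2 ^ w.length : ℤ) • cliffWord G w := by
  induction w with
  | nil => simp [cliffWord]
  | cons s w ih =>
    have h1 : Commute (1 + cliff G s) (cliffWord G w) :=
      (Commute.one_left _).add_left (cliff_commute_cliffWord G fun t ht =>
        hw s List.mem_cons_self t (List.mem_cons_of_mem _ ht))
    have h2 := ih fun a ha b hb => hw a (List.mem_cons_of_mem _ ha) b (List.mem_cons_of_mem _ hb)
    rw [cliffWord_cons, mul_assoc, ← mul_assoc (cliffWord G w), ← h1.eq, mul_assoc, h2, ← mul_assoc,
      one_add_mul_self_of_sq (cliff_mul_self G s), List.length_cons, pow_succ, mul_smul_comm,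
      mul_assoc, two_mul, mul_smul, two_smul]

theorem cliff_mul_cliffWord {s : V} {w : List V} (hw : ∀ s ∈ w, ∀ t ∈ w, ¬ G.Adj s t)
    (hs : s ∈ w) : cliff G s * cliffWord G w = cliffWord G w := by
  induction w with
  | nil => simp at hs
  | cons t w ih =>
    rw [cliffWord_cons, ← mul_assoc]
    by_cases hst : s = t
    · subst hst
      rw [mul_add, mul_one, cliff_mul_self, add_comm]
    · rw [(cliff_commute_one_add G (hw s hs t List.mem_cons_self)).eq, mul_assoc,
        ih (fun a ha b hb => hw a (List.mem_cons_of_mem _ ha) b (List.mem_cons_of_mem _ hb))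
          ((List.mem_cons.1 hs).resolve_left hst)]

/-- The product of the `g_s` along a word. -/
def cliffProd (l : List V) : Matrix (Finset V) (Finset V) ℤ := (l.map (cliff G)).prod

theorem cliffProd_cons (s : V) (l : List V) :
    cliffProd G (s :: l) = cliff G s * cliffProd G l := by
  simp [cliffProd]

theorem cliffProd_mul_cliffWord {l w : List V} (hw : ∀ s ∈ w, ∀ t ∈ w, ¬ G.Adj s t)
    (hl : l ⊆ w) : cliffProd G l * cliffWord G w = cliffWord G w := by
  induction l with
  | nil => simp [cliffProd]
  | cons s l ih =>
    rw [List.cons_subset] at hl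
    rw [cliffProd_cons, mul_assoc, ih hl.2, cliff_mul_cliffWord G hw hl.1]

/-- Up to a scalar, the product of the `g_s` over `l` acts by `X ↦ X ∆ l`. -/
theorem exists_cliffProd_mul_apply {l : List V} (hl : l.Nodup) : ∀ X : Finset V, ∃ ε : ℤ,
    ∀ (M : Matrix (Finset V) (Finset V) ℤ) (Y : Finset V),
      (cliffProd G l * M) X Y = ε * M (symmDiff X l.toFinset) Y := by
  induction l with
  | nil => exact fun X => ⟨1, fun M Y => by
      have h : symmDiff X ∅ = X := symmDiff_bot X
      simp [cliffProd, h]⟩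
  | cons s l ih =>
    intro X
    rw [List.nodup_cons] at hl
    obtain ⟨ε, hε⟩ := ih hl.2 (symmDiff X {s})
    refine ⟨edgeSign G s X * ε, fun M Y => ?_⟩
    have h : symmDiff {s} l.toFinset = (s :: l).toFinset := by
      rw [List.toFinset_cons]
      ext x
      simp only [mem_symmDiff, mem_singleton, mem_insert, List.mem_toFinset]
      by_cases hx : x = s
      · subst hx; simp [hl.1]
      · simp [hx]
    rw [cliffProd_cons, mul_assoc, cliff_mul_apply, hε, symmDiff_assoc, h, mul_assoc]

theorem trace_cliffProd_mul_cliffWord {l w : List V} (hl : l.Nodup) (hlw : ¬ l ⊆ w) :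
    (cliffProd G l * cliffWord G w).trace = 0 := by
  refine Finset.sum_eq_zero fun X _ => ?_
  obtain ⟨ε, hε⟩ := exists_cliffProd_mul_apply G hl X
  rw [Matrix.diag_apply, hε, cliffWord_apply_eq_zero, mul_zero]
  rw [symmDiff_comm X, symmDiff_symmDiff_cancel_right]
  exact fun h => hlw fun x hx => List.mem_toFinset.1 (h (List.mem_toFinset.2 hx))

theorem cliff_mul_cliffProd (s : V) (l : List V) :
    cliff G s * cliffProd G l =
      ((-1) ^ (l.countP fun t => G.Adj s t) : ℤ) • (cliffProd G l * cliff G s) := by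
  induction l with
  | nil => simp [cliffProd]
  | cons t l ih =>
    rw [cliffProd_cons, ← mul_assoc]
    by_cases h : G.Adj s t
    · rw [cliff_anticomm G h, neg_mul, mul_assoc, ih, List.countP_cons_of_pos (by simpa using h),
        pow_succ, mul_smul_comm, mul_assoc, mul_neg_one, neg_smul]
    · rw [cliff_comm G h, mul_assoc, ih, List.countP_cons_of_neg (by simpa using h),
        mul_smul_comm, mul_assoc]

/-- If every vertex has an even number of neighbours in `l`, the product of the `g_s` over `l` is
central. -/
theorem cliffProd_commute_cliffWord {l : List V} (hl : ∀ s, Even (l.countP fun t => G.Adj s t))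
    (w : List V) : Commute (cliffProd G l) (cliffWord G w) := by
  refine Commute.list_prod_right _ _ fun x hx => ?_
  obtain ⟨s, -, rfl⟩ := List.mem_map.1 hx
  refine (Commute.one_right _).add_right ?_
  have := cliff_mul_cliffProd G s l
  rw [(hl s).neg_one_pow, one_smul] at this
  exact this.symm

end Clifford

/-! ### The traces separating the classes -/

section Existence

instance (n : ℕ) : DecidableRel (typeEGraph n).Adj := fun _ _ =>
  inferInstanceAs (Decidable (_ ∨ _ ∨ _ ∨ _))

/-- The matrix attached to a word in the vertices of `E_n`, up to a power of `√2` the image of the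
monomial under a representation of the Temperley–Lieb algebra with `δ = √2`. -/
noncomputable def wordMatrix {n : ℕ} (w : List (Fin n)) :
    Matrix (Finset (Fin n)) (Finset (Fin n)) ℤ :=
  cliffWord (typeEGraph n) w

/-- The product of the involutions `g_s` over `{0, 4, 6, …}`. -/
noncomputable def evenMatrix (n : ℕ) : Matrix (Finset (Fin n)) (Finset (Fin n)) ℤ :=
  cliffProd (typeEGraph n) (evenSet n).toList

variable {n : ℕ}

/-- For odd `n` this set is the support of the kernel vector of the adjacency matrix modulo `2`. -/
theorem even_countP_evenSet (hn : n % 2 = 1) (s : Fin n) :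
    Even ((evenSet n).toList.countP fun t => (typeEGraph n).Adj s t) := by
  have h1 : ((evenSet n).toList.countP fun t => (typeEGraph n).Adj s t) =
      ((evenSet n).filter fun t => (typeEGraph n).Adj s t).card := by
    rw [← Multiset.coe_countP, Finset.coe_toList, Multiset.countP_eq_card_filter]
    rfl
  rw [h1]
  have hs := s.isLt
  by_cases hodd : s.val % 2 = 1 ∧ 3 ≤ s.val
  · have hadj : ∀ i : Fin n, (typeEGraph n).Adj s i ↔ AdjE s.val i.val := fun _ => Iff.rfl
    have h2 : ((evenSet n).filter fun t => (typeEGraph n).Adj s t) =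
        {⟨if s.val = 3 then 0 else s.val - 1, by split_ifs <;> omega⟩,
          ⟨s.val + 1, by omega⟩} := by
      ext i
      simp only [evenSet, Finset.mem_filter, Finset.mem_univ, true_and, Finset.mem_insert,
        Finset.mem_singleton, Fin.ext_iff, hadj, AdjE]
      split_ifs <;> omega
    rw [h2, Finset.card_pair]
    · exact even_two
    · intro h
      have := Fin.val_eq_of_eq h
      simp only at this
      split_ifs at this
      omega
  · rw [Finset.filter_eq_empty_iff.2, Finset.card_empty]
    · exact Even.zero
    · intro i hi hadj
      simp only [evenSet, Finset.mem_filter, Finset.mem_univ, true_and] at hi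
      have hadj' : AdjE s.val i.val := hadj
      unfold AdjE at hadj'
      omega

theorem evenMatrix_commute (hn : n % 2 = 1) (w : List (Fin n)) :
    evenMatrix n * wordMatrix w = wordMatrix w * evenMatrix n :=
  (cliffProd_commute_cliffWord _ (fun s => even_countP_evenSet hn s) w).eq

/-- The condition, for a word `w`, that the monomial `b_w` is a multiple of `i(A)` modulo
commutators for some `A` with the same size as `T`, and such that, for odd `n`, the set
`{0, 4, 6, …, n - 1}` is contained in both or none of `A` and `T`. -/
def SameClass (T : Finset (Fin n)) (w : List (Fin n)) : Prop :=
  (wordMatrix w * wordMatrix w).trace ≠ 0 ∧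
    2 ^ n * (wordMatrix w * wordMatrix w).trace = 2 ^ T.card * (wordMatrix w).trace ^ 2 ∧
    (n % 2 = 1 → ((evenMatrix n * wordMatrix w).trace ≠ 0 ↔ evenSet n ⊆ T))

/-- The exponent of `δ` in the expression of the monomial `b_w`, modulo commutators, as a
multiple of some `i(A)`. The trace is `2 ^ (n + #A)` for a word listing `A`, and under
`b_s b_s = δ b_s` and `b_s b_t b_s = b_s` the exponent changes by `2 - 1` and `2 - 2`. -/
noncomputable def deltaExponent (w : List (Fin n)) : ℤ :=
  (padicValInt 2 (wordMatrix w * wordMatrix w).trace : ℤ) - w.length - n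

/-- The condition is invariant under scaling of the matrix. -/
theorem sameClass_congr {T : Finset (Fin n)} {w w' : List (Fin n)}
    (h : wordMatrix w' = 2 * wordMatrix w) : SameClass T w' ↔ SameClass T w := by
  have h1 : (wordMatrix w' * wordMatrix w').trace = 4 * (wordMatrix w * wordMatrix w).trace := by
    rw [h]
    simp only [two_mul, add_mul, mul_add, Matrix.trace_add]
    ring
  have h2 : (wordMatrix w').trace = 2 * (wordMatrix w).trace := by
    rw [h, two_mul, two_mul, Matrix.trace_add]
  have h3 : (evenMatrix n * wordMatrix w').trace = 2 * (evenMatrix n * wordMatrix w).trace := by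
    rw [h, two_mul, two_mul, mul_add, Matrix.trace_add]
  unfold SameClass
  rw [h1, h2, h3]
  refine and_congr (by simp) (and_congr ⟨fun h => ?_, fun h => ?_⟩ (by simp))
  · linarith
  · linear_combination 4 * h

theorem padicValInt_congr {w w' : List (Fin n)} (h : wordMatrix w' = 2 * wordMatrix w)
    (hw : (wordMatrix w * wordMatrix w).trace ≠ 0) :
    padicValInt 2 (wordMatrix w' * wordMatrix w').trace =
      padicValInt 2 (wordMatrix w * wordMatrix w).trace + 2 := by
  have h1 : (wordMatrix w' * wordMatrix w').trace =
      (wordMatrix w * wordMatrix w).trace * 2 * 2 := by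
    rw [h]
    simp only [two_mul, add_mul, mul_add, Matrix.trace_add]
    ring
  have h2 : padicValInt 2 2 = 1 := padicValInt_self
  rw [h1, padicValInt.mul (by simpa using hw) two_ne_zero, padicValInt.mul hw two_ne_zero, h2]

section

variable {K : Type*} [Field K] [Algebra (LaurentPolynomial ℤ) K]

/-- For every set `T` there is a trace that is `1` on `i(A)` if `A` and `T` have the same size
and, for odd `n`, `{0, 4, 6, …, n - 1}` is contained in both or none of them, and that is `0` on the
other elements `i(A)`. -/
theorem exists_trace (hδ : deltaK K ≠ 0) (T : Finset (Fin n)) :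
    ∃ τ : TLK K n →ₗ[K] K, (∀ a b, τ (a * b) = τ (b * a)) ∧ ∀ A : IndepSets n,
      ((A.1.card = T.card ∧ (n % 2 = 1 → (evenSet n ⊆ A.1 ↔ evenSet n ⊆ T))) →
        τ (iEltK K A) = 1) ∧
      (¬ (A.1.card = T.card ∧ (n % 2 = 1 → (evenSet n ⊆ A.1 ↔ evenSet n ⊆ T))) →
        τ (iEltK K A) = 0) := by
  classical
  let φ : List (Fin n) → K := fun w => if SameClass T w then deltaK K ^ deltaExponent w else 0
  obtain ⟨τ, hτ⟩ := exists_linearMap_monomialK φ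
    (by
      intro x y s
      have h := cliffWord_sq (typeEGraph n) x y s
      simp only [φ]
      rw [sameClass_congr (T := T) (w := x ++ [s] ++ y) h]
      split_ifs with hc
      · rw [← zpow_one_add₀ hδ]
        congr 1
        unfold deltaExponent
        rw [padicValInt_congr (w := x ++ [s] ++ y) h hc.1]
        simp only [List.length_append, List.length_cons, List.length_nil]
        push_cast
        ring
      · rw [mul_zero])
    (by
      intro x y s t hst
      have h := cliffWord_adj (typeEGraph n) x y hst
      simp only [φ]
      rw [sameClass_congr (T := T) (w := x ++ [s] ++ y) h]
      split_ifs with hc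
      · congr 1
        unfold deltaExponent
        rw [padicValInt_congr (w := x ++ [s] ++ y) h hc.1]
        simp only [List.length_append, List.length_cons, List.length_nil]
        push_cast
        ring
      · rfl)
    (by
      intro x y s t _ hst
      have h : wordMatrix (x ++ [s, t] ++ y) = wordMatrix (x ++ [t, s] ++ y) :=
        cliffWord_comm (typeEGraph n) x y hst
      simp only [φ, SameClass, deltaExponent, h, List.length_append, List.length_cons,
        List.length_nil])
  refine ⟨τ, trace_of_monomialK fun u w => ?_, fun A => ?_⟩
  · rw [hτ, hτ]
    have hmul : ∀ u w : List (Fin n), wordMatrix (u ++ w) = wordMatrix u * wordMatrix w :=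
      fun u w => cliffWord_append _ u w
    have h1 : (wordMatrix (u ++ w)).trace = (wordMatrix (w ++ u)).trace := by
      rw [hmul, hmul, Matrix.trace_mul_comm]
    have h2 : (wordMatrix (u ++ w) * wordMatrix (u ++ w)).trace =
        (wordMatrix (w ++ u) * wordMatrix (w ++ u)).trace := by
      rw [hmul, hmul, mul_assoc, Matrix.trace_mul_comm]
      simp only [mul_assoc]
    have h3 : n % 2 = 1 → (evenMatrix n * wordMatrix (u ++ w)).trace =
        (evenMatrix n * wordMatrix (w ++ u)).trace := by
      intro hn
      rw [hmul, hmul, ← mul_assoc, evenMatrix_commute hn, mul_assoc, Matrix.trace_mul_comm,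
        mul_assoc]
    have h4 : SameClass T (u ++ w) ↔ SameClass T (w ++ u) := by
      unfold SameClass
      rw [h1, h2]
      refine and_congr_right' (and_congr_right' (forall_congr' fun hn => ?_))
      rw [h3 hn]
    simp only [φ, h4, deltaExponent, h2, List.length_append, add_comm u.length]
  · rw [iEltK_eq_monomialK, hτ]
    set w := A.1.toList with hw
    have hmem : ∀ s, s ∈ w ↔ s ∈ A.1 := fun s => Finset.mem_toList
    have hnodup : w.Nodup := Finset.nodup_toList _
    have hlen : w.length = A.1.card := Finset.length_toList _
    have hind : ∀ s ∈ w, ∀ t ∈ w, ¬ (typeEGraph n).Adj s t := fun s hs t ht hadj =>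
      A.2 ((hmem s).1 hs) ((hmem t).1 ht) hadj.ne hadj
    have h1 : (wordMatrix w).trace = 2 ^ n := by
      have := trace_cliffWord (typeEGraph n) hnodup
      rw [Fintype.card_fin] at this
      exact this
    have h2 : (wordMatrix w * wordMatrix w).trace = 2 ^ (A.1.card + n) := by
      have h : wordMatrix w * wordMatrix w = (2 ^ w.length : ℤ) • wordMatrix w :=
        cliffWord_mul_self (typeEGraph n) hind
      rw [h, Matrix.trace_smul, h1, hlen, smul_eq_mul, pow_add]
    have h3 : (evenMatrix n * wordMatrix w).trace ≠ 0 ↔ evenSet n ⊆ A.1 := by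
      constructor
      · intro h s hs
        by_contra hsA
        apply h
        refine trace_cliffProd_mul_cliffWord (typeEGraph n) (Finset.nodup_toList _) fun hsub => ?_
        exact hsA ((hmem s).1 (hsub (Finset.mem_toList.2 hs)))
      · intro h
        have : evenMatrix n * wordMatrix w = wordMatrix w :=
          cliffProd_mul_cliffWord (typeEGraph n) hind fun s hs =>
            (hmem s).2 (h (Finset.mem_toList.1 hs))
        rw [this, h1]
        positivity
    have h4 : SameClass T w ↔
        (A.1.card = T.card ∧ (n % 2 = 1 → (evenSet n ⊆ A.1 ↔ evenSet n ⊆ T))) := by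
      unfold SameClass
      rw [h1, h2, h3]
      refine (and_iff_right (by positivity)).trans (and_congr_left' ?_)
      rw [← pow_mul, ← pow_add, ← pow_add, pow_right_inj₀ two_pos (by norm_num)]
      omega
    have h5 : deltaExponent w = 0 := by
      have : padicValInt 2 ((2 : ℤ) ^ (A.1.card + n)) = A.1.card + n := by
        rw [padicValInt, Int.natAbs_pow]
        exact padicValNat.prime_pow _
      rw [deltaExponent, h2, hlen, this]
      push_cast
      ring
    simp only [φ, h4, h5, zpow_zero]
    exact ⟨fun h => if_pos h, fun h => if_neg h⟩

/-- A trace takes the same value on `b_x b_C` and `b_y b_C` if `x` and `y` are adjacent to each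
other and not adjacent to the letters of `C`: both are `δ` times the value on `b_x b_y b_C`. -/
theorem trace_monomialK_move {τ : TLK K n →ₗ[K] K} (hτ : ∀ a b, τ (a * b) = τ (b * a))
    {x y : Fin n} {u : List (Fin n)} (hxy : (typeEGraph n).Adj x y)
    (hx : ∀ t ∈ u, ¬ (typeEGraph n).Adj t x) (hy : ∀ t ∈ u, ¬ (typeEGraph n).Adj t y) :
    τ (monomialK K ([x] ++ u)) = τ (monomialK K ([y] ++ u)) := by
  have key : ∀ x y : Fin n, (typeEGraph n).Adj x y → (∀ t ∈ u, ¬ (typeEGraph n).Adj t x) →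
      τ (monomialK K ([x] ++ u)) = deltaK K * τ (monomialK K ([x, y] ++ u)) := by
    intro x y hxy hx
    have h1 : [x, y, x] = [x, y] ++ [x] := rfl
    have h2 : [x] ++ [x, y] = [x, x] ++ [y] := rfl
    have h3 : [x, y] = [x] ++ [y] := rfl
    rw [monomialK_append, ← monomialK_triple hxy, h1, monomialK_append, mul_assoc,
      ← monomialK_append, monomialK_singleton_append_comm hx, monomialK_append, ← mul_assoc, hτ,
      ← mul_assoc, ← monomialK_append, h2, monomialK_append, monomialK_pair, smul_mul_assoc,
      smul_mul_assoc, map_smul, smul_eq_mul, ← monomialK_append, ← h3, ← monomialK_append]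
  rw [key x y hxy hx, key y x hxy.symm hy]
  congr 1
  have h1 : [x, y] = [x] ++ [y] := rfl
  have h2 : [y, x] = [y] ++ [x] := rfl
  rw [h1, h2, monomialK_append, monomialK_append, monomialK_append, monomialK_append, mul_assoc,
    hτ, mul_assoc, mul_assoc, ← monomialK_append u, ← monomialK_singleton_append_comm hx,
    monomialK_append]

theorem trace_neighbours {τ : TLK K n →ₗ[K] K} (hτ : ∀ a b, τ (a * b) = τ (b * a))
    {A B : IndepSets n} (h : Neighbours A B) : τ (iEltK K A) = τ (iEltK K B) := by
  obtain ⟨h1, h2, s, t, h3, h4⟩ := h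
  have hA : (A.1 \ B.1).card = 1 := by
    have := Finset.card_sdiff_add_card_inter A.1 B.1
    omega
  have hB : (B.1 \ A.1).card = 1 := by
    have := Finset.card_sdiff_add_card_inter B.1 A.1
    rw [Finset.inter_comm] at this
    omega
  obtain ⟨x, hx⟩ := Finset.card_eq_one.1 hA
  obtain ⟨y, hy⟩ := Finset.card_eq_one.1 hB
  have hx' : x ∈ A.1 ∧ x ∉ B.1 := by
    rw [← Finset.mem_sdiff, hx]; exact Finset.mem_singleton_self x
  have hy' : y ∈ B.1 ∧ y ∉ A.1 := by
    rw [← Finset.mem_sdiff, hy]; exact Finset.mem_singleton_self y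
  have hxy : (typeEGraph n).Adj x y := by
    have hxm : x ∈ ({s, t} : Finset (Fin n)) := by rw [← h3]; simp [hx'.1, hx'.2]
    have hym : y ∈ ({s, t} : Finset (Fin n)) := by rw [← h3]; simp [hy'.1, hy'.2]
    have hne : x ≠ y := fun h => hy'.2 (h ▸ hx'.1)
    simp only [Finset.mem_insert, Finset.mem_singleton] at hxm hym
    rcases hxm with rfl | rfl <;> rcases hym with rfl | rfl
    · exact absurd rfl hne
    · exact h4
    · exact h4.symm
    · exact absurd rfl hne
  set u := (A.1 ∩ B.1).toList with hu
  have humem : ∀ r, r ∈ u ↔ r ∈ A.1 ∧ r ∈ B.1 := fun r => by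
    rw [hu, Finset.mem_toList, Finset.mem_inter]
  have hunodup : u.Nodup := Finset.nodup_toList _
  have huset : u.toFinset = A.1 ∩ B.1 := Finset.toList_toFinset _
  have hA' : A.1 = ([x] ++ u).toFinset := by
    rw [List.singleton_append, List.toFinset_cons, huset, Finset.insert_eq, ← hx,
      Finset.sdiff_union_inter]
  have hB' : B.1 = ([y] ++ u).toFinset := by
    rw [List.singleton_append, List.toFinset_cons, huset, Finset.insert_eq, ← hy,
      Finset.inter_comm, Finset.sdiff_union_inter]
  rw [iEltK_eq_monomialK_of_nodup (List.nodup_cons.2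
      ⟨fun h => hx'.2 ((humem x).1 h).2, hunodup⟩) A hA',
    iEltK_eq_monomialK_of_nodup (List.nodup_cons.2
      ⟨fun h => hy'.2 ((humem y).1 h).1, hunodup⟩) B hB']
  exact trace_monomialK_move hτ hxy
    (fun r hr hadj => A.2 ((humem r).1 hr).1 hx'.1 hadj.ne hadj)
    (fun r hr hadj => B.2 ((humem r).1 hr).2 hy'.1 hadj.ne hadj)

theorem trace_classOf {τ : TLK K n →ₗ[K] K} (hτ : ∀ a b, τ (a * b) = τ (b * a))
    {A B : IndepSets n} (h : classOf A = classOf B) : τ (iEltK K A) = τ (iEltK K B) := by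
  have h' : Relation.ReflTransGen Neighbours A B := Quotient.exact h
  induction h' with
  | refl => rfl
  | tail h1 h2 ih => exact (ih (Quotient.sound h1)).trans (trace_neighbours hτ h2)

/-- Every class has a trace that is `1` on its elements and `0` on those of other classes. -/
theorem exists_trace_class (hn : 6 ≤ n) (hδ : deltaK K ≠ 0) (c : IndepClasses n) :
    ∃ τ : TLK K n →ₗ[K] K, (∀ a b, τ (a * b) = τ (b * a)) ∧ ∀ A : IndepSets n,
      (classOf A = c → τ (iEltK K A) = 1) ∧ (classOf A ≠ c → τ (iEltK K A) = 0) := by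
  induction c using Quotient.inductionOn with
  | h A₀ =>
  obtain ⟨T, hT, hTp⟩ := exists_isPacked hn A₀
  change classOf T = Quotient.mk _ A₀ at hT
  rw [← hT]
  obtain ⟨τ, hτ, hval⟩ := exists_trace (K := K) hδ T.1
  refine ⟨τ, hτ, fun A => ⟨fun h => ?_, fun h => ?_⟩⟩
  · rw [trace_classOf hτ h]
    exact (hval T).1 ⟨rfl, fun _ => Iff.rfl⟩
  · obtain ⟨S, hS, hSp⟩ := exists_isPacked hn A
    rw [← trace_classOf hτ hS]
    refine (hval S).2 fun hST => h ?_
    have : S = T := Subtype.ext (hSp.eq_of_card_eq hTp hST.1 hST.2)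
    rw [← hS, this]

/-- Traces on `K ⊗ TL(E_n)` correspond to families of scalars indexed by the classes. -/
theorem exists_traceSpace_equiv (hn : 6 ≤ n) (hδ : deltaK K ≠ 0) :
    ∃ e : traceSpace K (TLK K n) ≃ₗ[K] (IndepClasses n → K),
      ∀ (τ : traceSpace K (TLK K n)) (A : IndepSets n), e τ (classOf A) = τ.1 (iEltK K A) := by
  classical
  have : Fintype (IndepClasses n) := Fintype.ofFinite _
  let ev : traceSpace K (TLK K n) →ₗ[K] (IndepClasses n → K) :=
    { toFun := fun τ c => τ.1 (iEltK K c.out)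
      map_add' := fun _ _ => rfl
      map_smul' := fun _ _ => rfl }
  have hev : ∀ (τ : traceSpace K (TLK K n)) (A : IndepSets n),
      ev τ (classOf A) = τ.1 (iEltK K A) := fun τ A =>
    trace_classOf τ.2 (Quotient.out_eq (classOf A))
  choose σ hσ hσA using fun c => exists_trace_class (K := K) hn hδ c
  refine ⟨LinearEquiv.ofBijective ev ⟨?_, fun f => ?_⟩, hev⟩
  · intro σ' τ h
    refine Subtype.ext (trace_ext (by omega) hδ σ'.2 τ.2 fun A => ?_)
    rw [← hev, ← hev, h]
  · refine ⟨∑ c, f c • ⟨σ c, hσ c⟩, funext fun d => ?_⟩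
    rw [map_sum, Finset.sum_apply, Finset.sum_eq_single d]
    · have : ev ⟨σ d, hσ d⟩ d = 1 := (hσA d _).1 (Quotient.out_eq d)
      rw [map_smul, Pi.smul_apply, this, smul_eq_mul, mul_one]
    · intro c _ hcd
      have : ev ⟨σ c, hσ c⟩ d = 0 := (hσA c _).2 fun h => hcd (h.symm.trans (Quotient.out_eq d))
      rw [map_smul, Pi.smul_apply, this, smul_zero]
    · exact fun h => absurd (Finset.mem_univ d) h

end

end Existence

/-! ### The basis of the space of traces -/

theorem theorem5p3 (n : ℕ) (hn : 6 ≤ n) (K : Type*) [Field K] [Algebra (LaurentPolynomial ℤ) K]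
    (hK : Function.Injective (algebraMap (LaurentPolynomial ℤ) K))
    (hδ : ∃ r : K, r ^ 2 = algebraMap (LaurentPolynomial ℤ) K deltaParam) :
    (∀ c : IndepClasses n, ∃! τ : TLK K n →ₗ[K] K,
      (∀ a b : TLK K n, τ (a * b) = τ (b * a)) ∧
        ∀ B : IndepSets n,
          (classOf B = c → τ (iEltK K B) = 1) ∧ (classOf B ≠ c → τ (iEltK K B) = 0)) ∧
    ∃ β : Module.Basis (IndepClasses n) K (traceSpace K (TLK K n)),
      ∀ (c : IndepClasses n) (B : IndepSets n),
        (classOf B = c → (β c : TLK K n →ₗ[K] K) (iEltK K B) = 1) ∧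
          (classOf B ≠ c → (β c : TLK K n →ₗ[K] K) (iEltK K B) = 0) := by
  classical
  have hδ' : deltaK K ≠ 0 := deltaK_ne_zero K hK
  obtain ⟨e, he⟩ := exists_traceSpace_equiv (K := K) hn hδ'
  have : Fintype (IndepClasses n) := Fintype.ofFinite _
  constructor
  · intro c
    obtain ⟨τ, hτ, hval⟩ := exists_trace_class (K := K) hn hδ' c
    refine ⟨τ, ⟨hτ, hval⟩, fun σ hσ => ?_⟩
    refine trace_ext (by omega) hδ' hσ.1 hτ fun A => ?_
    by_cases h : classOf A = c
    · rw [(hσ.2 A).1 h, (hval A).1 h]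
    · rw [(hσ.2 A).2 h, (hval A).2 h]
  · refine ⟨Module.Basis.ofEquivFun e, fun c B => ?_⟩
    rw [← he, Module.Basis.coe_ofEquivFun, LinearEquiv.apply_symm_apply]
    exact ⟨fun h => by rw [h, Pi.single_eq_same], fun h => Pi.single_eq_of_ne h _⟩
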